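/- Let $\alpha,\beta$ be complex numbers with $|\alpha|>1$ and $|\beta|>1$, and fix logarithms $\log\alpha$, $\log\beta$. Let $H_{\alpha,\beta}$ be the Hopf surface obtained as the quotient of $\mathbb C^2\setminus 0$ by the group generated by $(z_1,z_2)\mapsto(\alpha z_1,\beta z_2)$, and write $[z_1,z_2]$ for the class of $(z_1,z_2)$. Give $S^1\times S^3$, where $S^1=\mathbb R/2\pi\mathbb Z$ and $S^3\subset\mathbb C^2$ is the unit sphere, the complex structure $J$ transferred from $H_{\alpha,\beta}$ through the homeomorphism $$F:S^1\times S^3\to H_{\alpha,\beta},\qquad (\theta,(\xi_1,\xi_2))\mapsto\bigl[e^{\theta\log\alpha/2\pi}\xi_1,\;e^{\theta\log\beta/2\pi}\xi_2\bigr].$$ Let $\mathcal E_{\alpha,\beta}$ be the foliation of $S^1\times S^3$ tangent to $B$ and $JB$, where $B$ is the vector field which in the coordinates $(z_1,z_2)$ is $B=-2\,(z_1\log|\alpha|,\,z_2\log|\beta|)$. Let $\Delta$ be its leaf space, with the quotient topology, and $\Psi:S^1\times S^3\to\Delta$ the projection. Suppose that $\alpha^{m_0}=\beta^{n_0}$ for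 some integers $m_0,n_0$ that are not both zero. Then there are least positive integers $m,n$ with $\alpha^m=\beta^n$ (both are minimal simultaneously), and there is a homeomorphism $h:\Delta\to\mathbb{CP}^1$ such that: 1. $h\circ\Psi$ is holomorphic with respect to $J$; that is, $\Psi$ is holomorphic for the complex structure induced on $\Delta$ by $h$; 2. $h\circ\Psi$ is induced by $(z_1,z_2)\mapsto[z_1^m:z_2^n]$: if $F(p)=[z_1,z_2]$ then $h(\Psi(p))=[z_1^m:z_2^n]$; 3. every fibre of $\Psi$ (that is, every leaf of $\mathcal E_{\alpha,\beta}$) is a complex torus: there are a lattice $\Lambda\subset\mathbb C$ and a holomorphic immersion $\varphi:\mathbb C\to (S^1\times S^3,J)$ whose image is the fibre and such that $\varphi(u)=\varphi(v)$ if and only if $u-v\in\Lambda$. Thus $h\circ\Psi\circ F^{-1}:H_{\alpha,\beta}\to\mathbb{CP}^1$ is an elliptic fibration. -/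

import Mathlib

open scoped LinearAlgebra.Projectivization Manifold ContDiff Topology

noncomputable section

namespace Hopf

/-- The complex plane `ℂ²` with its Hermitian norm. -/
abbrev C2 := EuclideanSpace ℂ (Fin 2)

/-- `ℂ² ∖ 0`, as an open subset of `ℂ²`. -/
def puncturedC2 : TopologicalSpace.Opens C2 := ⟨{0}ᶜ, isOpen_compl_singleton⟩

/-- The sphere `S³ = {(ξ₁, ξ₂) : |ξ₁|² + |ξ₂|² = 1}`. -/
abbrev S3 := Metric.sphere (0 : C2) 1

/-- The diagonal linear map `(z₁, z₂) ↦ (s z₁, t z₂)`. -/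
def diag (s t : ℂ) (z : C2) : C2 := !₂[s * z 0, t * z 1]

@[simp] lemma diag_zero_coord (s t : ℂ) (z : C2) : diag s t z 0 = s * z 0 := by simp [diag]
@[simp] lemma diag_one_coord (s t : ℂ) (z : C2) : diag s t z 1 = t * z 1 := by simp [diag]

lemma C2_ext {z w : C2} (h0 : z 0 = w 0) (h1 : z 1 = w 1) : z = w := by
  ext i; fin_cases i <;> assumption

lemma diag_diag (s t s' t' : ℂ) (z : C2) :
    diag s t (diag s' t' z) = diag (s * s') (t * t') z := by
  apply C2_ext <;> simp [mul_assoc]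

lemma diag_ne_zero {s t : ℂ} (hs : s ≠ 0) (ht : t ≠ 0) {z : C2} (hz : z ≠ 0) :
    diag s t z ≠ 0 := by
  intro h
  apply hz
  have h0 := congrArg (fun w : C2 => w 0) h
  have h1 := congrArg (fun w : C2 => w 1) h
  simp [hs, ht] at h0 h1
  exact C2_ext (by simpa using h0) (by simpa using h1)

lemma continuous_diag {X : Type*} [TopologicalSpace X] {s t : X → ℂ} {z : X → C2}
    (hs : Continuous s) (ht : Continuous t) (hz : Continuous z) :
    Continuous fun x => diag (s x) (t x) (z x) := by
  unfold diag
  fun_prop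

lemma norm_sq_C2 (z : C2) : ‖z‖ ^ 2 = ‖z 0‖ ^ 2 + ‖z 1‖ ^ 2 := by
  simp [EuclideanSpace.norm_sq_eq]

/-- The parameters of a class 1 primary Hopf surface: complex numbers `α`, `β` of modulus greater
than one, together with a choice `logα`, `logβ` of their logarithms. -/
structure Params where
  α : ℂ
  β : ℂ
  logα : ℂ
  logβ : ℂ
  one_lt_norm_α : 1 < ‖α‖
  one_lt_norm_β : 1 < ‖β‖
  exp_logα : Complex.exp logα = α
  exp_logβ : Complex.exp logβ = β

namespace Params

variable (P : Params)

lemma α_ne_zero : P.α ≠ 0 := P.exp_logα ▸ Complex.exp_ne_zero _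
lemma β_ne_zero : P.β ≠ 0 := P.exp_logβ ▸ Complex.exp_ne_zero _

lemma logα_re_pos : 0 < P.logα.re := by
  have := P.one_lt_norm_α
  rwa [← P.exp_logα, Complex.norm_exp, Real.one_lt_exp_iff] at this

lemma logβ_re_pos : 0 < P.logβ.re := by
  have := P.one_lt_norm_β
  rwa [← P.exp_logβ, Complex.norm_exp, Real.one_lt_exp_iff] at this

end Params

/-- Two points of `ℂ² ∖ 0` are equivalent when they lie on the same orbit of the group generated
by `(z₁, z₂) ↦ (α z₁, β z₂)`. -/
def hopfSetoid (P : Params) : Setoid puncturedC2 where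
  r z w := ∃ k : ℤ, (w : C2) = diag (P.α ^ k) (P.β ^ k) z
  iseqv :=
    { refl := fun z => ⟨0, C2_ext (by simp) (by simp)⟩
      symm := by
        rintro z w ⟨k, hk⟩
        refine ⟨-k, ?_⟩
        have ha := zpow_ne_zero k P.α_ne_zero
        have hb := zpow_ne_zero k P.β_ne_zero
        rw [hk, diag_diag]
        apply C2_ext <;> simp [zpow_neg, ha, hb]
      trans := by
        rintro z w v ⟨k, hk⟩ ⟨l, hl⟩
        refine ⟨l + k, ?_⟩
        rw [hl, hk, diag_diag, zpow_add₀ P.α_ne_zero, zpow_add₀ P.β_ne_zero] }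

/-- The Hopf surface `H_{α,β}`, the quotient of `ℂ² ∖ 0` by the group generated by
`(z₁, z₂) ↦ (α z₁, β z₂)`. -/
def Surface (P : Params) : Type := Quotient (hopfSetoid P)

instance (P : Params) : TopologicalSpace (Surface P) :=
  inferInstanceAs (TopologicalSpace (Quotient (hopfSetoid P)))

/-- The projection `(z₁, z₂) ↦ [z₁, z₂]` of `ℂ² ∖ 0` onto `H_{α,β}`. -/
def toSurface (P : Params) (z : puncturedC2) : Surface P := Quotient.mk (hopfSetoid P) z

lemma toSurface_eq_iff {P : Params} {z w : puncturedC2} :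
    toSurface P z = toSurface P w ↔ ∃ k : ℤ, (w : C2) = diag (P.α ^ k) (P.β ^ k) z :=
  Quotient.eq (r := hopfSetoid P)

lemma toSurface_surjective (P : Params) : Function.Surjective (toSurface P) :=
  Quotient.mk_surjective

lemma continuous_toSurface (P : Params) : Continuous (toSurface P) := continuous_quot_mk

/-- The `k`-th iterate of `(z₁, z₂) ↦ (α z₁, β z₂)` on `ℂ² ∖ 0`. -/
def deck (P : Params) (k : ℤ) (z : puncturedC2) : puncturedC2 :=
  ⟨diag (P.α ^ k) (P.β ^ k) z,
    diag_ne_zero (zpow_ne_zero k P.α_ne_zero) (zpow_ne_zero k P.β_ne_zero) z.2⟩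

lemma continuous_deck (P : Params) (k : ℤ) : Continuous (deck P k) :=
  (continuous_diag continuous_const continuous_const continuous_subtype_val).subtype_mk _

lemma toSurface_deck (P : Params) (k : ℤ) (z : puncturedC2) :
    toSurface P (deck P k z) = toSurface P z :=
  (toSurface_eq_iff.2 ⟨k, rfl⟩).symm

lemma isOpenMap_toSurface (P : Params) : IsOpenMap (toSurface P) := by
  intro U hU
  have hq : IsOpen (toSurface P ⁻¹' (toSurface P '' U)) := by
    have : toSurface P ⁻¹' (toSurface P '' U) = ⋃ k : ℤ, deck P k ⁻¹' U := by
      ext z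
      simp only [Set.mem_preimage, Set.mem_image, Set.mem_iUnion]
      constructor
      · rintro ⟨w, hw, h⟩
        obtain ⟨k, hk⟩ := toSurface_eq_iff.1 h.symm
        refine ⟨k, ?_⟩
        have : deck P k z = w := Subtype.ext hk.symm
        rwa [this]
      · rintro ⟨k, hk⟩
        exact ⟨_, hk, toSurface_deck P k z⟩
    rw [this]
    exact isOpen_iUnion fun k => hU.preimage (continuous_deck P k)
  exact hq

/-- A neighbourhood of a point of an annulus meets none of its translates. -/
lemma zpow_annulus {c : ℂ} (hc : 1 < ‖c‖) {r : ℝ} {u v : ℂ} {k : ℤ}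
    (hu1 : r < ‖u‖) (hu2 : ‖u‖ < r * ‖c‖) (hv1 : r < ‖v‖) (hv2 : ‖v‖ < r * ‖c‖)
    (h : v = c ^ k * u) : k = 0 := by
  have hn : ‖v‖ = ‖c‖ ^ k * ‖u‖ := by rw [h, norm_mul, norm_zpow]
  rcases lt_trichotomy k 0 with hk | hk | hk
  · exfalso
    have h1 : ‖c‖ ^ k ≤ ‖c‖ ^ (-1 : ℤ) := zpow_le_zpow_right₀ hc.le (by omega)
    have h2 : ‖v‖ ≤ ‖c‖ ^ (-1 : ℤ) * ‖u‖ := by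
      rw [hn]; exact mul_le_mul_of_nonneg_right h1 (norm_nonneg _)
    rw [zpow_neg_one, inv_mul_eq_div, le_div_iff₀ (by linarith)] at h2
    nlinarith
  · exact hk
  · exfalso
    have h1 : ‖c‖ ^ (1 : ℤ) ≤ ‖c‖ ^ k := zpow_le_zpow_right₀ hc.le (by omega)
    have h2 : ‖c‖ ^ (1 : ℤ) * ‖u‖ ≤ ‖v‖ := by
      rw [hn]; exact mul_le_mul_of_nonneg_right h1 (norm_nonneg _)
    rw [zpow_one] at h2
    nlinarith

lemma exists_injOn_toSurface (P : Params) (z : puncturedC2) :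
    ∃ U : Set puncturedC2, IsOpen U ∧ z ∈ U ∧ Set.InjOn (toSurface P) U := by
  have key : ∀ (i : Fin 2) (c : ℂ), 1 < ‖c‖ → (z : C2) i ≠ 0 →
      (∀ k : ℤ, ∀ w : C2, diag (P.α ^ k) (P.β ^ k) w i = c ^ k * w i) →
      ∃ U : Set puncturedC2, IsOpen U ∧ z ∈ U ∧ Set.InjOn (toSurface P) U := by
    intro i c hc hz hd
    obtain ⟨r, hr1, hr2⟩ : ∃ r : ℝ, ‖(z : C2) i‖ / ‖c‖ < r ∧ r < ‖(z : C2) i‖ :=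
      exists_between (div_lt_self (norm_pos_iff.2 hz) hc)
    rw [div_lt_iff₀ (by linarith)] at hr1
    have hcont : Continuous fun w : puncturedC2 => ‖(w : C2) i‖ := by fun_prop
    refine ⟨{w | r < ‖(w : C2) i‖ ∧ ‖(w : C2) i‖ < r * ‖c‖},
      (isOpen_lt continuous_const hcont).inter (isOpen_lt hcont continuous_const),
      ⟨hr2, hr1⟩, ?_⟩
    rintro u ⟨hu1, hu2⟩ v ⟨hv1, hv2⟩ huv
    obtain ⟨k, hk⟩ := toSurface_eq_iff.1 huv
    have hk0 : k = 0 := zpow_annulus hc hu1 hu2 hv1 hv2 (by rw [hk, hd])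
    subst hk0
    refine Subtype.ext (Eq.symm ?_)
    rw [hk]
    apply C2_ext <;> simp
  by_cases h0 : (z : C2) 0 = 0
  · have h1 : (z : C2) 1 ≠ 0 := fun h1 => z.2 (C2_ext (by simpa using h0) (by simpa using h1))
    exact key 1 P.β P.one_lt_norm_β h1 (by simp)
  · exact key 0 P.α P.one_lt_norm_α h0 (by simp)

lemma isLocalHomeomorph_toSurface (P : Params) : IsLocalHomeomorph (toSurface P) := by
  rw [isLocalHomeomorph_iff_isOpenEmbedding_restrict]
  intro z
  obtain ⟨U, hU, hz, hinj⟩ := exists_injOn_toSurface P z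
  refine ⟨U, hU.mem_nhds hz, .of_continuous_injective_isOpenMap
    ((continuous_toSurface P).comp continuous_subtype_val) ?_ ?_⟩
  · exact Set.injOn_iff_injective.1 hinj
  · exact (isOpenMap_toSurface P).comp hU.isOpenMap_subtype_val

/-- The complex structure of `H_{α,β}`: its charts are the local inverses of the projection
`ℂ² ∖ 0 → H_{α,β}`. -/
instance (P : Params) : ChartedSpace C2 (Surface P) :=
  (isLocalHomeomorph_toSurface P).chartedSpace (toSurface_surjective P)

/-- The manifold `S¹ × S³`, where `S¹ = ℝ / 2πℤ`. The parameters are recorded in the type since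
the complex structure put on it below depends on them. -/
def S1S3 (_P : Params) : Type := AddCircle (2 * Real.pi) × S3

instance (P : Params) : TopologicalSpace (S1S3 P) :=
  inferInstanceAs (TopologicalSpace (AddCircle (2 * Real.pi) × S3))

/-- The map `ℝ × S³ → ℂ² ∖ 0`,
`(θ, (ξ₁, ξ₂)) ↦ (exp (θ log α / 2π) ξ₁, exp (θ log β / 2π) ξ₂)`. -/
def cover (P : Params) (θ : ℝ) (ξ : S3) : puncturedC2 :=
  ⟨diag (Complex.exp (θ * P.logα / (2 * Real.pi))) (Complex.exp (θ * P.logβ / (2 * Real.pi))) ξ,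
    diag_ne_zero (Complex.exp_ne_zero _) (Complex.exp_ne_zero _) (ne_zero_of_mem_unit_sphere ξ)⟩

lemma cover_add_two_pi (P : Params) (θ : ℝ) (k : ℤ) (ξ : S3) :
    cover P (θ + k * (2 * Real.pi)) ξ = deck P k (cover P θ ξ) := by
  have hpi : (Real.pi : ℂ) ≠ 0 := Complex.ofReal_ne_zero.2 Real.pi_ne_zero
  have h : ∀ c : ℂ, Complex.exp (((θ + k * (2 * Real.pi) : ℝ) : ℂ) * c / (2 * Real.pi))
      = Complex.exp c ^ k * Complex.exp (θ * c / (2 * Real.pi)) := by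
    intro c
    rw [← Complex.exp_int_mul, ← Complex.exp_add]
    congr 1
    push_cast
    field_simp
    ring
  apply Subtype.ext
  simp only [cover, deck, diag_diag, h, P.exp_logα, P.exp_logβ]

/-- `‖(exp (-θ log α / 2π) z₁, exp (-θ log β / 2π) z₂)‖²`. -/
def radius (P : Params) (θ : ℝ) (z : C2) : ℝ :=
  ‖z 0‖ ^ 2 * Real.exp (-(θ * (P.logα.re / Real.pi))) +
    ‖z 1‖ ^ 2 * Real.exp (-(θ * (P.logβ.re / Real.pi)))

/-- `(exp (-θ log α / 2π) z₁, exp (-θ log β / 2π) z₂)`. -/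
def unroll (P : Params) (θ : ℝ) (z : C2) : C2 :=
  diag (Complex.exp (-(θ * P.logα / (2 * Real.pi)))) (Complex.exp (-(θ * P.logβ / (2 * Real.pi)))) z

lemma norm_exp_sq (θ : ℝ) (c : ℂ) :
    ‖Complex.exp (-(θ * c / (2 * Real.pi)))‖ ^ 2 = Real.exp (-(θ * (c.re / Real.pi))) := by
  have hre : (-(θ * c / (2 * Real.pi)) : ℂ).re = -(θ * c.re / (2 * Real.pi)) := by
    have : (-(θ * c / (2 * Real.pi)) : ℂ) = ((-(θ / (2 * Real.pi)) : ℝ) : ℂ) * c := by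
      push_cast; ring
    rw [this, Complex.re_ofReal_mul]; ring
  rw [Complex.norm_exp, hre, ← Real.exp_nat_mul]
  congr 1
  push_cast
  field_simp

lemma norm_unroll_sq (P : Params) (θ : ℝ) (z : C2) : ‖unroll P θ z‖ ^ 2 = radius P θ z := by
  rw [norm_sq_C2, unroll, diag_zero_coord, diag_one_coord, norm_mul, norm_mul, mul_pow, mul_pow,
    norm_exp_sq, norm_exp_sq, radius]
  ring

lemma radius_strictAnti (P : Params) {z : C2} (hz : z ≠ 0) :
    StrictAnti fun θ => radius P θ z := by
  intro s t hst
  have ha : 0 < P.logα.re / Real.pi := div_pos P.logα_re_pos Real.pi_pos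
  have hb : 0 < P.logβ.re / Real.pi := div_pos P.logβ_re_pos Real.pi_pos
  have h1 : Real.exp (-(t * (P.logα.re / Real.pi))) < Real.exp (-(s * (P.logα.re / Real.pi))) :=
    Real.exp_lt_exp.2 (by nlinarith)
  have h2 : Real.exp (-(t * (P.logβ.re / Real.pi))) < Real.exp (-(s * (P.logβ.re / Real.pi))) :=
    Real.exp_lt_exp.2 (by nlinarith)
  show radius P t z < radius P s z
  unfold radius
  by_cases h0 : z 0 = 0
  · have h1' : z 1 ≠ 0 := fun h => hz (C2_ext (by simpa using h0) (by simpa using h))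
    have : 0 < ‖z 1‖ ^ 2 := by positivity
    have : 0 ≤ ‖z 0‖ ^ 2 := by positivity
    nlinarith
  · have : 0 < ‖z 0‖ ^ 2 := by positivity
    have : 0 ≤ ‖z 1‖ ^ 2 := by positivity
    nlinarith

lemma continuous_radius (P : Params) : Continuous fun x : ℝ × C2 => radius P x.1 x.2 := by
  unfold radius
  fun_prop

lemma exists_radius_eq_one (P : Params) {z : C2} (hz : z ≠ 0) : ∃ θ, radius P θ z = 1 := by
  have ha : 0 < P.logα.re / Real.pi := div_pos P.logα_re_pos Real.pi_pos
  have hb : 0 < P.logβ.re / Real.pi := div_pos P.logβ_re_pos Real.pi_pos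
  have hcont : Continuous fun θ => radius P θ z :=
    (continuous_radius P).comp (continuous_id.prodMk continuous_const)
  have hexp : ∀ c : ℝ, 0 < c → Filter.Tendsto (fun θ : ℝ => Real.exp (-(θ * c)))
      Filter.atTop (𝓝 0) := fun c hc =>
    Real.tendsto_exp_neg_atTop_nhds_zero.comp (Filter.tendsto_id.atTop_mul_const hc)
  have hexp' : ∀ c : ℝ, 0 < c → Filter.Tendsto (fun θ : ℝ => Real.exp (-(θ * c)))
      Filter.atBot Filter.atTop := fun c hc =>
    Real.tendsto_exp_atTop.comp
      (Filter.tendsto_neg_atBot_atTop.comp (Filter.tendsto_id.atBot_mul_const hc))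
  have hlow : ∃ θ, radius P θ z ≤ 1 := by
    have h : Filter.Tendsto (fun θ => radius P θ z) Filter.atTop (𝓝 (‖z 0‖ ^ 2 * 0 + ‖z 1‖ ^ 2 * 0)) :=
      ((hexp _ ha).const_mul _).add ((hexp _ hb).const_mul _)
    simp only [mul_zero, add_zero] at h
    obtain ⟨θ, hθ⟩ := (h.eventually (gt_mem_nhds one_pos)).exists
    exact ⟨θ, hθ.le⟩
  have hhigh : ∃ θ, 1 ≤ radius P θ z := by
    by_cases h0 : z 0 = 0
    · have h1' : z 1 ≠ 0 := fun h => hz (C2_ext (by simpa using h0) (by simpa using h))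
      have h := (hexp' _ hb).const_mul_atTop (show 0 < ‖z 1‖ ^ 2 by positivity)
      obtain ⟨θ, hθ⟩ := (h.eventually (Filter.eventually_ge_atTop 1)).exists
      exact ⟨θ, by unfold radius; have : 0 ≤ ‖z 0‖ ^ 2 * Real.exp (-(θ * (P.logα.re / Real.pi))) := by
                    positivity
                   linarith⟩
    · have h := (hexp' _ ha).const_mul_atTop (show 0 < ‖z 0‖ ^ 2 by positivity)
      obtain ⟨θ, hθ⟩ := (h.eventually (Filter.eventually_ge_atTop 1)).exists
      exact ⟨θ, by unfold radius; have : 0 ≤ ‖z 1‖ ^ 2 * Real.exp (-(θ * (P.logβ.re / Real.pi))) := by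
                    positivity
                   linarith⟩
  exact mem_range_of_exists_le_of_exists_ge hcont hlow hhigh

/-- The unique real number `θ` with
`|z₁|² / exp (θ log |α| / π) + |z₂|² / exp (θ log |β| / π) = 1`. -/
def angle (P : Params) (z : puncturedC2) : ℝ := (exists_radius_eq_one P z.2).choose

lemma radius_angle (P : Params) (z : puncturedC2) : radius P (angle P z) z = 1 :=
  (exists_radius_eq_one P z.2).choose_spec

lemma angle_eq {P : Params} {z : puncturedC2} {θ : ℝ} (h : radius P θ z = 1) : angle P z = θ :=
  (radius_strictAnti P z.2).injective ((radius_angle P z).trans h.symm)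

lemma continuous_angle (P : Params) : Continuous (angle P) := by
  rw [continuous_iff_continuousAt]
  intro z
  have hc : ∀ c, Continuous fun w : puncturedC2 => radius P c (w : C2) := fun c =>
    (continuous_radius P).comp (continuous_const.prodMk continuous_subtype_val)
  refine tendsto_order.2 ⟨fun c hlt => ?_, fun c hlt => ?_⟩
  · have : 1 < radius P c z := radius_angle P z ▸ radius_strictAnti P z.2 hlt
    filter_upwards [(isOpen_lt continuous_const (hc c)).mem_nhds this] with w hw
    by_contra hle
    have := (radius_strictAnti P w.2).antitone (not_lt.1 hle)
    simp only [radius_angle] at this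
    exact absurd hw (not_lt.2 this)
  · have : radius P c z < 1 := radius_angle P z ▸ radius_strictAnti P z.2 hlt
    filter_upwards [(isOpen_lt (hc c) continuous_const).mem_nhds this] with w hw
    by_contra hle
    have := (radius_strictAnti P w.2).antitone (not_lt.1 hle)
    simp only [radius_angle] at this
    exact absurd hw (not_lt.2 this)

/-- The point `(exp (-θ log α / 2π) z₁, exp (-θ log β / 2π) z₂)` of `S³`, where `θ = angle z`. -/
def spherePart (P : Params) (z : puncturedC2) : S3 :=
  ⟨unroll P (angle P z) z, by
    have h := norm_unroll_sq P (angle P z) z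
    rw [radius_angle] at h
    have h' := (pow_eq_one_iff_of_nonneg (norm_nonneg _) two_ne_zero).1 h
    simpa using h'⟩

lemma continuous_spherePart (P : Params) : Continuous (spherePart P) := by
  refine Continuous.subtype_mk ?_ _
  have := continuous_angle P
  unfold unroll
  exact continuous_diag (by fun_prop) (by fun_prop) continuous_subtype_val

lemma unroll_cover (P : Params) (θ : ℝ) (ξ : S3) : unroll P θ (cover P θ ξ) = ξ := by
  apply C2_ext <;> simp [unroll, cover, ← mul_assoc, ← Complex.exp_add]

lemma angle_cover (P : Params) (θ : ℝ) (ξ : S3) : angle P (cover P θ ξ) = θ := by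
  apply angle_eq
  rw [← norm_unroll_sq, unroll_cover]
  simp

lemma spherePart_cover (P : Params) (θ : ℝ) (ξ : S3) : spherePart P (cover P θ ξ) = ξ := by
  apply Subtype.ext
  simp only [spherePart, angle_cover, unroll_cover]

lemma cover_angle (P : Params) (z : puncturedC2) :
    cover P (angle P z) (spherePart P z) = z := by
  apply Subtype.ext
  apply C2_ext <;> simp [spherePart, unroll, cover, ← mul_assoc, ← Complex.exp_add]

lemma angle_deck (P : Params) (k : ℤ) (z : puncturedC2) :
    angle P (deck P k z) = angle P z + k * (2 * Real.pi) ∧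
      spherePart P (deck P k z) = spherePart P z := by
  have h := cover_add_two_pi P (angle P z) k (spherePart P z)
  rw [cover_angle] at h
  rw [← h, angle_cover, spherePart_cover]
  exact ⟨rfl, rfl⟩

lemma continuous_cover (P : Params) : Continuous fun x : ℝ × S3 => cover P x.1 x.2 :=
  Continuous.subtype_mk
    (continuous_diag (by fun_prop) (by fun_prop) (continuous_subtype_val.comp continuous_snd)) _

/-- The homeomorphism `F_{α,β} : S¹ × S³ → H_{α,β}`,
`(θ, (ξ₁, ξ₂)) ↦ [exp (θ log α / 2π) ξ₁, exp (θ log β / 2π) ξ₂]`. -/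
def F (P : Params) : S1S3 P ≃ₜ Surface P where
  toFun p := Quotient.lift (fun θ : ℝ => toSurface P (cover P θ p.2)) (by
    intro s t hst
    obtain ⟨k, hk⟩ := AddSubgroup.mem_zmultiples_iff.1 (QuotientAddGroup.leftRel_apply.1 hst)
    have : t = s + k * (2 * Real.pi) := by
      simp only [zsmul_eq_mul] at hk; linarith
    show toSurface P (cover P s p.2) = toSurface P (cover P t p.2)
    rw [this, cover_add_two_pi, toSurface_deck]) p.1
  invFun := Quotient.lift (fun z : puncturedC2 =>
      (((angle P z : AddCircle (2 * Real.pi)), spherePart P z) : S1S3 P)) (by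
    rintro z w ⟨k, hk⟩
    have : w = deck P k z := Subtype.ext hk
    obtain ⟨h1, h2⟩ := angle_deck P k z
    rw [this, h1, h2]
    congr 1
    rw [AddCircle.coe_add, left_eq_add, AddCircle.coe_eq_zero_iff]
    exact ⟨k, by simp⟩)
  left_inv := by
    rintro ⟨θ, ξ⟩
    induction θ using QuotientAddGroup.induction_on with
    | H θ =>
      show (((angle P (cover P θ ξ) : AddCircle (2 * Real.pi)), spherePart P (cover P θ ξ)) :
        S1S3 P) = _
      rw [angle_cover, spherePart_cover]
  right_inv := by
    intro x
    induction x using Quotient.inductionOn with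
    | h z =>
      show toSurface P (cover P (angle P z) (spherePart P z)) = toSurface P z
      rw [cover_angle]
  continuous_toFun := by
    have hq : IsOpenQuotientMap
        (Prod.map ((↑) : ℝ → AddCircle (2 * Real.pi)) (id : S3 → S3)) :=
      (QuotientAddGroup.isOpenQuotientMap_mk).prodMap .id
    refine hq.isQuotientMap.continuous_iff.2 ?_
    exact (continuous_toSurface P).comp (continuous_cover P)
  continuous_invFun := by
    refine Continuous.quotient_lift ?_ _
    exact Continuous.prodMk ((AddCircle.continuous_mk' _).comp (continuous_angle P))
      (continuous_spherePart P)

/-- The complex structure `J_{α,β}` of `S¹ × S³`, transferred from `H_{α,β}` through `F_{α,β}`. -/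
instance (P : Params) : ChartedSpace C2 (S1S3 P) := (F P).symm.chartedSpace

/-- The point `(θ mod 2π, ξ)` of `S¹ × S³`. -/
def S1S3.mk (P : Params) (θ : ℝ) (ξ : S3) : S1S3 P := ((θ : AddCircle (2 * Real.pi)), ξ)

lemma F_mk (P : Params) (θ : ℝ) (ξ : S3) : F P (S1S3.mk P θ ξ) = toSurface P (cover P θ ξ) := rfl

lemma isManifold_surface_aux (P : Params) (z z' : puncturedC2) :
    ContDiffOn ℂ ω
      ((((isLocalHomeomorph_toSurface P).localInverseAt z).trans (chartAt C2 z)).symm.trans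
        (((isLocalHomeomorph_toSurface P).localInverseAt z').trans (chartAt C2 z')))
      ((((isLocalHomeomorph_toSurface P).localInverseAt z).trans (chartAt C2 z)).symm.trans
        (((isLocalHomeomorph_toSurface P).localInverseAt z').trans (chartAt C2 z'))).source := by
  set H := isLocalHomeomorph_toSurface P
  intro x hx
  have hc : ∀ y : puncturedC2, chartAt C2 z' y = (y : C2) := fun y => rfl
  have hs : ∀ y (hy : y ≠ (0 : C2)), (chartAt C2 z).symm y = ⟨y, hy⟩ := by
    intro y hy
    have h1 : (⟨y, hy⟩ : puncturedC2) ∈ (chartAt C2 z).source := by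
      rw [TopologicalSpace.Opens.chartAt_eq]; simp [chartAt_self_eq]
    exact (chartAt C2 z).left_inv h1
  have ht : ∀ y ∈ (chartAt C2 z).target, y ≠ (0 : C2) := by
    intro y hy h0
    have h2 : (((chartAt C2 z).symm y : puncturedC2) : C2) = y := (chartAt C2 z).right_inv hy
    exact ((chartAt C2 z).symm y).2 (h2.trans h0)
  have hval : ∀ y (hy : y ≠ (0 : C2)),
      ((H.localInverseAt z).trans (chartAt C2 z)).symm.trans
        ((H.localInverseAt z').trans (chartAt C2 z')) y
        = (H.localInverseAt z' (toSurface P ⟨y, hy⟩) : C2) := by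
    intro y hy
    simp only [OpenPartialHomeomorph.coe_trans, OpenPartialHomeomorph.coe_trans_symm,
      Function.comp_apply, IsLocalHomeomorph.localInverseAt_symm, hc]
    rw [hs y hy]
  simp only [OpenPartialHomeomorph.trans_source, OpenPartialHomeomorph.trans_symm_eq_symm_trans_symm,
    OpenPartialHomeomorph.symm_source, Set.mem_inter_iff, Set.mem_preimage,
    OpenPartialHomeomorph.coe_trans, Function.comp_apply,
    IsLocalHomeomorph.localInverseAt_symm] at hx
  have hx0 : x ≠ 0 := ht x hx.1.1
  rw [hs x hx0] at hx
  have hmem : toSurface P ⟨x, hx0⟩ ∈ (H.localInverseAt z').source := hx.2.1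
  obtain ⟨k, hk⟩ := toSurface_eq_iff.1 (H.apply_localInverseAt_of_mem hmem).symm
  have hk' : H.localInverseAt z' (toSurface P ⟨x, hx0⟩) = deck P k ⟨x, hx0⟩ := Subtype.ext hk
  have hev : ∀ᶠ y : puncturedC2 in 𝓝 ⟨x, hx0⟩,
      H.localInverseAt z' (toSurface P y) = deck P k y := by
    have hopen : IsOpen (deck P k ⁻¹' (H.localInverseAt z').target) :=
      (H.localInverseAt z').open_target.preimage (continuous_deck P k)
    have hin : (⟨x, hx0⟩ : puncturedC2) ∈ deck P k ⁻¹' (H.localInverseAt z').target := by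
      rw [Set.mem_preimage, ← hk']
      exact (H.localInverseAt z').map_source hmem
    filter_upwards [hopen.mem_nhds hin] with y hy
    have h := (H.localInverseAt z').right_inv hy
    rw [H.localInverseAt_symm, toSurface_deck] at h
    exact h
  have hev' : ∀ᶠ y : C2 in 𝓝 x, ∀ hy : y ≠ 0,
      H.localInverseAt z' (toSurface P ⟨y, hy⟩) = deck P k ⟨y, hy⟩ := by
    have h1 := (puncturedC2.isOpen.isOpenEmbedding_subtypeVal.map_nhds_eq ⟨x, hx0⟩)
    change Filter.map _ _ = 𝓝 x at h1
    rw [← h1, Filter.eventually_map]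
    filter_upwards [hev] with y hy hy0
    exact hy
  have hlin : ContDiffAt ℂ ω (fun y : C2 => diag (P.α ^ k) (P.β ^ k) y) x := by
    rw [contDiffAt_euclidean]
    intro i
    fin_cases i <;> simp [diag] <;> fun_prop
  refine (hlin.congr_of_eventuallyEq ?_).contDiffWithinAt
  filter_upwards [hev', isOpen_compl_singleton.mem_nhds hx0] with y hy hy0
  rw [hval y hy0, hy hy0]
  rfl

instance (P : Params) : IsManifold 𝓘(ℂ, C2) ω (Surface P) := by
  refine isManifold_of_contDiffOn _ _ _ ?_
  rintro e e' ⟨q, rfl⟩ ⟨q', rfl⟩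
  simpa using isManifold_surface_aux P _ _

instance (P : Params) : IsManifold 𝓘(ℂ, C2) ω (S1S3 P) := by
  refine isManifold_of_contDiffOn _ _ _ ?_
  rintro e e' ⟨q, rfl⟩ ⟨q', rfl⟩
  simp only [modelWithCornersSelf_coe, modelWithCornersSelf_coe_symm, Set.preimage_id_eq, id_eq,
    Set.range_id, Set.inter_univ, Function.comp_id, Function.id_comp]
  set H := (F P).symm.isLocalHomeomorph
  set g := (F P).symm.surjective.hasRightInverse.choose
  have hF : ∀ (y : Surface P) (x : S1S3 P), x ∈ (H.localInverseAt y).source →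
      H.localInverseAt y x = F P x := by
    intro y x hx
    have := H.apply_localInverseAt_of_mem hx
    rw [← (F P).apply_symm_apply (H.localInverseAt y x), this]
  have hcomp : ContDiffOn ℂ ω ((chartAt C2 (g q)).symm.trans (chartAt C2 (g q')))
      ((chartAt C2 (g q)).symm.trans (chartAt C2 (g q'))).source := by
    have := contMDiffOn_of_mem_contDiffGroupoid (I := 𝓘(ℂ, C2)) (n := ω)
      (StructureGroupoid.compatible (contDiffGroupoid ω 𝓘(ℂ, C2))
        (chart_mem_atlas C2 (g q)) (chart_mem_atlas C2 (g q')))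
    exact contMDiffOn_iff_contDiffOn.1 this
  have hkey : ∀ x ∈ (((H.localInverseAt (g q)).trans (chartAt C2 (g q))).symm.trans
      ((H.localInverseAt (g q')).trans (chartAt C2 (g q')))).source,
      x ∈ ((chartAt C2 (g q)).symm.trans (chartAt C2 (g q'))).source ∧
      ((H.localInverseAt (g q)).trans (chartAt C2 (g q))).symm.trans
      ((H.localInverseAt (g q')).trans (chartAt C2 (g q'))) x =
        (chartAt C2 (g q)).symm.trans (chartAt C2 (g q')) x := by
    intro x hx
    simp only [OpenPartialHomeomorph.trans_source, OpenPartialHomeomorph.trans_symm_eq_symm_trans_symm,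
      OpenPartialHomeomorph.symm_source, Set.mem_inter_iff, Set.mem_preimage,
      OpenPartialHomeomorph.coe_trans, Function.comp_apply,
      IsLocalHomeomorph.localInverseAt_symm] at hx ⊢
    have h1 := hF _ _ hx.2.1
    rw [Homeomorph.apply_symm_apply] at h1
    rw [h1] at hx ⊢
    exact ⟨⟨hx.1.1, hx.2.2⟩, rfl⟩
  exact (hcomp.mono fun x hx => (hkey x hx).1).congr fun x hx => (hkey x hx).2

/-- The Lee vector field `B = -2 (z₁ log |α|, z₂ log |β|)`, in the coordinates of `ℂ² ∖ 0`. -/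
def leeField (P : Params) (z : C2) : C2 :=
  diag (-2 * Real.log ‖P.α‖ : ℝ) (-2 * Real.log ‖P.β‖ : ℝ) z

/-- The curve `t ↦ (θ t mod 2π, ξ t)` of `S¹ × S³` is a `C¹` curve tangent to the distribution
spanned by `B` and `J B`, where `J` is the complex structure `J_{α,β}`. Since `F_{α,β}` transports
`J_{α,β}` to the multiplication by `i`, the tangency is expressed for the image of the curve
under `F_{α,β}`, lifted to `ℂ² ∖ 0`. Every continuous curve of `S¹ × S³` is of the form
`t ↦ (θ t mod 2π, ξ t)` with `θ` and `ξ` continuous. -/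
def IsTangentCurve (P : Params) (θ : ℝ → ℝ) (ξ : ℝ → S3) : Prop :=
  ∃ u v : ℝ → ℝ, Continuous u ∧ Continuous v ∧ ∀ t,
    HasDerivAt (fun s => (cover P (θ s) (ξ s) : C2))
      (u t • leeField P (cover P (θ t) (ξ t)) +
        v t • (Complex.I • leeField P (cover P (θ t) (ξ t)))) t

/-- Two points of `S¹ × S³` are joined by a `C¹` curve tangent to the distribution spanned by
`B` and `J B`. -/
def JoinedInLeaf (P : Params) (p q : S1S3 P) : Prop :=
  ∃ (θ : ℝ → ℝ) (ξ : ℝ → S3), IsTangentCurve P θ ξ ∧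
    S1S3.mk P (θ 0) (ξ 0) = p ∧ S1S3.mk P (θ 1) (ξ 1) = q

/-- The leaf space `Δ` of the foliation `E_{α,β}` of `S¹ × S³`, with the quotient topology. The
leaf of a point is the set of the points that are joined to it by a piecewise `C¹` curve tangent
to the distribution spanned by `B` and `J B`. (`Quot` is the quotient by the equivalence relation
generated by `JoinedInLeaf`.) -/
def LeafSpace (P : Params) : Type := Quot (JoinedInLeaf P)

instance (P : Params) : TopologicalSpace (LeafSpace P) :=
  inferInstanceAs (TopologicalSpace (Quot (JoinedInLeaf P)))

/-- The projection `Ψ : S¹ × S³ → Δ`. -/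
def leafProj (P : Params) (p : S1S3 P) : LeafSpace P := Quot.mk (JoinedInLeaf P) p

/-- The complex projective line. -/
def CP1 : Type := ℙ ℂ (Fin 2 → ℂ)

namespace CP1

/-- The point `[v₀ : v₁]` of `ℂP¹`. -/
def mk (v : Fin 2 → ℂ) (hv : v ≠ 0) : CP1 := Projectivization.mk ℂ v hv

/-- The quotient topology of `ℂP¹`. -/
instance : TopologicalSpace CP1 :=
  inferInstanceAs (TopologicalSpace (Quotient (projectivizationSetoid ℂ (Fin 2 → ℂ))))

/-- The canonical projection `ℂ² ∖ 0 → ℂP¹`. -/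
def proj (v : {v : Fin 2 → ℂ // v ≠ 0}) : CP1 := mk v v.2

lemma proj_surjective : Function.Surjective proj := Quotient.mk_surjective

lemma isQuotientMap_proj : Topology.IsQuotientMap proj := isQuotientMap_quot_mk

lemma proj_eq_iff {v w : {v : Fin 2 → ℂ // v ≠ 0}} :
    proj v = proj w ↔ ∃ a : ℂ, a • (w : Fin 2 → ℂ) = v :=
  Projectivization.mk_eq_mk_iff' ℂ _ _ v.2 w.2

/-- The points of `ℂP¹` whose `i`-th homogeneous coordinate does not vanish. -/
def domain (i : Fin 2) : Set CP1 := proj '' {v : {v : Fin 2 → ℂ // v ≠ 0} | (v : Fin 2 → ℂ) i ≠ 0}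

lemma preimage_domain (i : Fin 2) : proj ⁻¹' domain i = {v : {v : Fin 2 → ℂ // v ≠ 0} | (v : Fin 2 → ℂ) i ≠ 0} := by
  ext v
  constructor
  · rintro ⟨w, hw, h⟩
    obtain ⟨a, ha⟩ := proj_eq_iff.1 h
    intro hv
    apply hw
    rw [← ha]
    simp [hv]
  · exact fun h => ⟨v, h, rfl⟩

lemma isOpen_domain (i : Fin 2) : IsOpen (domain i) := by
  rw [← isQuotientMap_proj.isOpen_preimage, preimage_domain]
  exact isOpen_ne_fun ((continuous_apply i).comp continuous_subtype_val) continuous_const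

/-- The quotient of the other homogeneous coordinate by the `i`-th one. -/
def coord (i : Fin 2) : CP1 → ℂ :=
  Projectivization.lift (fun v => (v : Fin 2 → ℂ) (1 - i) / (v : Fin 2 → ℂ) i) (by
    rintro ⟨a, ha⟩ ⟨b, hb⟩ t h
    simp only at h
    subst h
    have ht : t ≠ 0 := by rintro rfl; simp at ha
    simp [mul_div_mul_left _ _ ht])

lemma coord_proj (i : Fin 2) (v : {v : Fin 2 → ℂ // v ≠ 0}) :
    coord i (proj v) = (v : Fin 2 → ℂ) (1 - i) / (v : Fin 2 → ℂ) i := rfl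

/-- The vector whose `i`-th coordinate is `1` and whose other coordinate is `w`. -/
def vec (i : Fin 2) (w : ℂ) : {v : Fin 2 → ℂ // v ≠ 0} :=
  ⟨fun k => if k = i then 1 else w, fun h => by simpa using congrFun h i⟩

/-- The `i`-th affine chart of `ℂP¹`: `[v₀ : v₁] ↦ v₁ / v₀` for `i = 0` and
`[v₀ : v₁] ↦ v₀ / v₁` for `i = 1`. -/
def chart (i : Fin 2) : OpenPartialHomeomorph CP1 ℂ where
  toFun := coord i
  invFun w := proj (vec i w)
  source := domain i
  target := Set.univ
  map_source' _ _ := Set.mem_univ _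
  map_target' w _ := ⟨vec i w, by simp [vec], rfl⟩
  left_inv' := by
    rintro _ ⟨v, hv, rfl⟩
    rw [proj_eq_iff, coord_proj]
    have hv' : (v : Fin 2 → ℂ) i ≠ 0 := hv
    refine ⟨((v : Fin 2 → ℂ) i)⁻¹, ?_⟩
    funext k
    fin_cases i <;> fin_cases k <;> simp [vec] at hv' ⊢ <;> field_simp
  right_inv' w _ := by
    rw [coord_proj]
    fin_cases i <;> simp [vec]
  open_source := isOpen_domain i
  open_target := isOpen_univ
  continuousOn_toFun := by
    rw [isQuotientMap_proj.continuousOn_isOpen_iff (isOpen_domain i), preimage_domain]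
    refine ContinuousOn.div (f := fun v : {v : Fin 2 → ℂ // v ≠ 0} => (v : Fin 2 → ℂ) (1 - i))
      (g := fun v => (v : Fin 2 → ℂ) i) ?_ ?_ (fun v hv => hv)
    · exact ((continuous_apply (1 - i)).comp continuous_subtype_val).continuousOn
    · exact ((continuous_apply i).comp continuous_subtype_val).continuousOn
  continuousOn_invFun := by
    refine (isQuotientMap_proj.continuous.comp (Continuous.subtype_mk ?_ _)).continuousOn
    refine continuous_pi fun k => ?_
    by_cases hk : k = i
    · simpa [hk] using continuous_const
    · simpa [hk] using continuous_id'

lemma exists_mem_domain (x : CP1) : ∃ i, x ∈ domain i := by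
  obtain ⟨v, rfl⟩ := proj_surjective x
  by_contra! h
  apply v.2
  funext i
  by_contra hi
  exact h i ⟨v, hi, rfl⟩

/-- The complex structure of `ℂP¹`, given by the two affine charts. -/
instance : ChartedSpace ℂ CP1 where
  atlas := Set.range chart
  chartAt x := chart (exists_mem_domain x).choose
  mem_chart_source x := (exists_mem_domain x).choose_spec
  chart_mem_atlas _ := ⟨_, rfl⟩

instance : IsManifold 𝓘(ℂ) ω CP1 := by
  refine isManifold_of_contDiffOn _ _ _ ?_
  rintro _ _ ⟨i, rfl⟩ ⟨j, rfl⟩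
  simp only [modelWithCornersSelf_coe, modelWithCornersSelf_coe_symm, Set.preimage_id_eq, id_eq,
    Set.range_id, Set.inter_univ, Function.comp_id, Function.id_comp]
  have hval : ∀ w, (chart i).symm.trans (chart j) w =
      (vec i w : Fin 2 → ℂ) (1 - j) / (vec i w : Fin 2 → ℂ) j := fun w => rfl
  have hsrc : ∀ w ∈ ((chart i).symm.trans (chart j)).source, (vec i w : Fin 2 → ℂ) j ≠ 0 := by
    intro w hw
    have h : proj (vec i w) ∈ domain j := hw.2
    have : vec i w ∈ proj ⁻¹' domain j := h
    rwa [preimage_domain] at this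
  have hvec : ∀ k, ContDiff ℂ ω fun w => (vec i w : Fin 2 → ℂ) k := by
    intro k
    by_cases hk : k = i
    · simpa [vec, hk] using contDiff_const
    · simpa [vec, hk] using contDiff_fun_id
  exact ((hvec (1 - j)).contDiffOn.div (hvec j).contDiffOn hsrc).congr fun w _ => hval w

end CP1

/-- The map `ℂ² ∖ 0 → ℂP¹`, `(z₁, z₂) ↦ [z₁ ^ m : z₂ ^ n]`. -/
def powRatio (m n : ℕ) (z : puncturedC2) : CP1 :=
  CP1.mk ![(z : C2) 0 ^ m, (z : C2) 1 ^ n] fun h => z.2 <| by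
    have h0 := congrFun h 0
    have h1 := congrFun h 1
    exact C2_ext (eq_zero_of_pow_eq_zero (by simpa using h0))
      (eq_zero_of_pow_eq_zero (by simpa using h1))

end Hopf

end

noncomputable section
namespace Hopf

/-! The field `B` is, up to the factor -2, the generator of the complex one-parameter group `flow`,
which multiplies the coordinates by exp (u log |α|) and exp (u log |β|). Tangent curves of the
distribution spanned by `B` and `J B` are therefore orbit paths with complex time, and the leaves
are the images of the orbits (`joinedInLeaf_flow`, `JoinedInLeaf.exists_flow`).

The relation α^m = β^n makes [z₁^m : z₂^n] invariant under the deck group, and its consequence m log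
|α| = n log |β| makes it invariant under the flow; so it descends to the leaf space. Injectivity is
where minimality of (m, n) matters. Writing m log α = n log β + 2πi r, the minimal relation has
gcd(m, n, r) = 1 (`Params.IsLeastRelation.exists_bezout`). A pair of points with the same image then
differs by a flow time and a deck transformation, because the linear Diophantine equation for the
branches of the logarithms is solvable (`Params.IsLeastRelation.exists_exp_eq`). A continuous
bijection from the compact leaf space onto the Hausdorff line is a homeomorphism.

The stabilizer of a point of S¹ × S³ under the flow consists of the times u at which the flow acts
on a lift as a deck transformation. The same arithmetic exhibits two real-independent generators of
it (`Params.IsLeastRelation.exists_periodPair_flow`), so each leaf is a torus. Holomorphy is checked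
upstairs, since the charts are local inverses of the projection from ℂ² ∖ 0. -/

lemma Params.log_norm_α (P : Params) : Real.log ‖P.α‖ = P.logα.re := by
  rw [← P.exp_logα, Complex.norm_exp, Real.log_exp]

lemma Params.log_norm_β (P : Params) : Real.log ‖P.β‖ = P.logβ.re := by
  rw [← P.exp_logβ, Complex.norm_exp, Real.log_exp]

/-! ### The complex flow and the projection of ℂ² ∖ 0 onto S¹ × S³ -/

/-- The holomorphic flow `(z₁, z₂) ↦ (exp (u log |α|) z₁, exp (u log |β|) z₂)`, with complex
time `u`, whose orbits in `ℂ² ∖ 0` cover the leaves. -/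
def flow (P : Params) (u : ℂ) (z : puncturedC2) : puncturedC2 :=
  ⟨diag (Complex.exp (u * P.logα.re)) (Complex.exp (u * P.logβ.re)) z,
    diag_ne_zero (Complex.exp_ne_zero _) (Complex.exp_ne_zero _) z.2⟩

lemma flow_add (P : Params) (u v : ℂ) (z : puncturedC2) :
    flow P (u + v) z = flow P u (flow P v z) := by
  apply Subtype.ext
  simp only [flow, diag_diag, ← Complex.exp_add, add_mul]

lemma flow_zero (P : Params) (z : puncturedC2) : flow P 0 z = z :=
  Subtype.ext (C2_ext (by simp [flow]) (by simp [flow]))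

lemma flow_deck (P : Params) (u : ℂ) (k : ℤ) (z : puncturedC2) :
    flow P u (deck P k z) = deck P k (flow P u z) := by
  apply Subtype.ext
  simp only [flow, deck, diag_diag, mul_comm]

lemma flow_injective (P : Params) (u : ℂ) : Function.Injective (flow P u) := by
  intro z w h
  have := congrArg (flow P (-u)) h
  simpa [← flow_add, flow_zero] using this

/-- The projection of `ℂ² ∖ 0` onto `S¹ × S³`, the composite of the projection onto `H_{α,β}`
and of the inverse of `F_{α,β}`. -/
def toS1S3 (P : Params) (z : puncturedC2) : S1S3 P := (F P).symm (toSurface P z)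

lemma F_toS1S3 (P : Params) (z : puncturedC2) : F P (toS1S3 P z) = toSurface P z :=
  (F P).apply_symm_apply _

lemma toS1S3_surjective (P : Params) : Function.Surjective (toS1S3 P) :=
  (F P).symm.surjective.comp (toSurface_surjective P)

lemma toS1S3_eq_iff {P : Params} {z w : puncturedC2} :
    toS1S3 P z = toS1S3 P w ↔ ∃ k : ℤ, w = deck P k z := by
  rw [toS1S3, toS1S3, (F P).symm.injective.eq_iff, toSurface_eq_iff]
  simp only [Subtype.ext_iff, deck]

lemma toS1S3_deck (P : Params) (k : ℤ) (z : puncturedC2) :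
    toS1S3 P (deck P k z) = toS1S3 P z :=
  (toS1S3_eq_iff.2 ⟨k, rfl⟩).symm

lemma mk_eq_toS1S3 (P : Params) (θ : ℝ) (ξ : S3) :
    S1S3.mk P θ ξ = toS1S3 P (cover P θ ξ) := by
  rw [toS1S3, ← F_mk, Homeomorph.symm_apply_apply]

lemma mk_angle (P : Params) (z : puncturedC2) :
    S1S3.mk P (angle P z) (spherePart P z) = toS1S3 P z := by
  rw [mk_eq_toS1S3, cover_angle]

/-! ### Tangent curves as paths in flow orbits -/

lemma hasDerivAt_C2_iff {f : ℝ → C2} {f' : C2} {t : ℝ} :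
    HasDerivAt f f' t ↔
      HasDerivAt (fun s => f s 0) (f' 0) t ∧ HasDerivAt (fun s => f s 1) (f' 1) t := by
  refine ⟨fun h => ⟨(PiLp.proj (𝕜 := ℝ) 2 (fun _ : Fin 2 => ℂ) 0).hasFDerivAt.comp_hasDerivAt t h,
    (PiLp.proj (𝕜 := ℝ) 2 (fun _ : Fin 2 => ℂ) 1).hasFDerivAt.comp_hasDerivAt t h⟩, ?_⟩
  rintro ⟨h0, h1⟩
  have h : HasDerivAt (fun s i => f s i) (fun i => f' i) t := by
    rw [hasDerivAt_pi]
    intro i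
    fin_cases i
    exacts [h0, h1]
  exact (PiLp.continuousLinearEquiv 2 ℝ
    (fun _ : Fin 2 => ℂ)).symm.toContinuousLinearMap.hasFDerivAt.comp_hasDerivAt t h

/-- The path t ↦ `flow P (t * u) z` is tangent to the distribution with constant coefficients;
`angle` and `spherePart` supply continuous cylinder coordinates for it. -/
lemma joinedInLeaf_flow (P : Params) (u : ℂ) (z : puncturedC2) :
    JoinedInLeaf P (toS1S3 P z) (toS1S3 P (flow P u z)) := by
  refine ⟨fun t => angle P (flow P (t * u) z), fun t => spherePart P (flow P (t * u) z),
    ?_, ?_, ?_⟩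
  -- The velocity is u times the generator -B/2, hence -(Re u)/2 · B - (Im u)/2 · iB.
  · refine ⟨fun _ => -u.re / 2, fun _ => -u.im / 2, continuous_const, continuous_const,
      fun t => ?_⟩
    simp only [cover_angle]
    have key : ∀ c x : ℂ, HasDerivAt (fun s : ℝ => Complex.exp (s * u * c) * x)
        (u * c * (Complex.exp (t * u * c) * x)) t := by
      intro c x
      have h1 : HasDerivAt (fun s : ℝ => (s : ℂ) * u * c) (1 * u * c) t :=
        ((Complex.ofRealCLM.hasDerivAt (x := t)).mul_const u).mul_const c
      exact (h1.cexp.mul_const x).congr_deriv (by ring)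
    have hu := Complex.re_add_im u
    rw [hasDerivAt_C2_iff]
    constructor
    · convert key P.logα.re ((z : C2) 0) using 1
      · simp [flow]
      · simp [flow, leeField, P.log_norm_α]
        linear_combination
          (P.logα.re * Complex.exp (t * u * P.logα.re) * (z : C2) 0) * hu
    · convert key P.logβ.re ((z : C2) 1) using 1
      · simp [flow]
      · simp [flow, leeField, P.log_norm_β]
        linear_combination
          (P.logβ.re * Complex.exp (t * u * P.logβ.re) * (z : C2) 1) * hu
  · simp [mk_angle, flow_zero]
  · simp [mk_angle]

/-- A solution of `f' = c g f` with `c` constant is the exponential of `c` times a primitive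
of `g`. -/
lemma eq_exp_integral_mul {f g : ℝ → ℂ} (c : ℂ) (hg : Continuous g)
    (hf : ∀ t, HasDerivAt f (g t * c * f t) t) (t : ℝ) :
    f t = Complex.exp ((∫ s in (0 : ℝ)..t, g s) * c) * f 0 := by
  have hW : ∀ t, HasDerivAt (fun t => ∫ s in (0 : ℝ)..t, g s) (g t) t := fun t =>
    intervalIntegral.integral_hasDerivAt_right (hg.intervalIntegrable _ _)
      (hg.stronglyMeasurableAtFilter _ _) hg.continuousAt
  -- Integrating factor: f times the inverse of the expected exponential has zero derivative.
  have hE : ∀ t, HasDerivAt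
      (fun t => Complex.exp (-((∫ s in (0 : ℝ)..t, g s) * c)) * f t) 0 t := by
    intro t
    exact (((hW t).mul_const c).fun_neg.cexp.mul (hf t)).congr_deriv (by ring)
  have hconst := is_const_of_deriv_eq_zero (fun t => (hE t).differentiableAt)
    (fun t => (hE t).deriv) t 0
  simp only [intervalIntegral.integral_same, zero_mul, neg_zero, Complex.exp_zero, one_mul]
    at hconst
  rw [← hconst, ← mul_assoc, ← Complex.exp_add]
  simp

/-- Each coordinate of a lifted tangent curve solves a scalar linear equation with the same
time-dependent factor g and rate log |α| or log |β|. Integrating both gives the flow at the common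
complex time ∫ g over [0, 1]. -/
lemma JoinedInLeaf.exists_flow {P : Params} {p q : S1S3 P} (h : JoinedInLeaf P p q) :
    ∃ u z, p = toS1S3 P z ∧ q = toS1S3 P (flow P u z) := by
  obtain ⟨θ, ξ, ⟨u, v, hu, hv, hd⟩, rfl, rfl⟩ := h
  -- The factor -2 comes from the normalization of `leeField`.
  set g : ℝ → ℂ := fun t => -2 * (u t + v t * Complex.I) with hg
  have hgc : Continuous g := by fun_prop
  refine ⟨∫ s in (0 : ℝ)..1, g s, cover P (θ 0) (ξ 0), mk_eq_toS1S3 _ _ _, ?_⟩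
  rw [mk_eq_toS1S3]
  congr 1
  apply Subtype.ext
  apply C2_ext
  · rw [eq_exp_integral_mul (f := fun t => (cover P (θ t) (ξ t) : C2) 0) (P.logα.re : ℂ) hgc]
    · simp [flow]
    · intro t
      convert (hasDerivAt_C2_iff.1 (hd t)).1 using 1
      simp [leeField, hg, P.log_norm_α]
      ring
  · rw [eq_exp_integral_mul (f := fun t => (cover P (θ t) (ξ t) : C2) 1) (P.logβ.re : ℂ) hgc]
    · simp [flow]
    · intro t
      convert (hasDerivAt_C2_iff.1 (hd t)).2 using 1
      simp [leeField, hg, P.log_norm_β]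
      ring

/-! ### Separation of the projective line -/

namespace CP1

/-- The saturation of an open set is the union of its multiples by nonzero scalars. Openness is what
reduces the Hausdorff property to closedness of the equivalence relation. -/
lemma isOpenQuotientMap_proj : IsOpenQuotientMap proj := by
  refine ⟨proj_surjective, isQuotientMap_proj.continuous, fun U hU => ?_⟩
  rw [← isQuotientMap_proj.isOpen_preimage]
  have hsmul : ∀ (a : ℂˣ) (v : {v : Fin 2 → ℂ // v ≠ 0}), a • (v : Fin 2 → ℂ) ≠ 0 := fun a v =>
    (smul_ne_zero_iff_ne a).2 v.2
  have : proj ⁻¹' (proj '' U) = ⋃ a : ℂˣ,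
      (fun v : {v : Fin 2 → ℂ // v ≠ 0} =>
        (⟨a • (v : Fin 2 → ℂ), hsmul a v⟩ : {v : Fin 2 → ℂ // v ≠ 0})) ⁻¹' U := by
    ext v
    simp only [Set.mem_preimage, Set.mem_image, Set.mem_iUnion]
    constructor
    · rintro ⟨w, hw, h⟩
      obtain ⟨a, ha⟩ := proj_eq_iff.1 h
      have ha0 : a ≠ 0 := by
        rintro rfl
        exact w.2 (by rw [← ha, zero_smul])
      refine ⟨Units.mk0 a ha0, ?_⟩
      convert hw using 1
      exact Subtype.ext ha
    · rintro ⟨a, ha⟩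
      exact ⟨_, ha, proj_eq_iff.2 ⟨a, rfl⟩⟩
  rw [this]
  exact isOpen_iUnion fun a => hU.preimage
    ((continuous_subtype_val.const_smul a).subtype_mk _)

/-- Proportionality as the vanishing of a 2 × 2 determinant, a closed condition in (v, w). -/
lemma proj_eq_iff_mul {v w : {v : Fin 2 → ℂ // v ≠ 0}} :
    proj v = proj w ↔
      (v : Fin 2 → ℂ) 0 * (w : Fin 2 → ℂ) 1 = (v : Fin 2 → ℂ) 1 * (w : Fin 2 → ℂ) 0 := by
  rw [proj_eq_iff]
  constructor
  · rintro ⟨a, ha⟩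
    rw [← ha]
    simp only [Pi.smul_apply, smul_eq_mul]
    ring
  · intro h
    by_cases hw : (w : Fin 2 → ℂ) 0 = 0
    · have hw1 : (w : Fin 2 → ℂ) 1 ≠ 0 := fun h1 => w.2 (by ext i; fin_cases i <;> assumption)
      refine ⟨(v : Fin 2 → ℂ) 1 / (w : Fin 2 → ℂ) 1, ?_⟩
      ext i
      fin_cases i
      · simp_all
      · simp [hw1]
    · refine ⟨(v : Fin 2 → ℂ) 0 / (w : Fin 2 → ℂ) 0, ?_⟩
      ext i
      fin_cases i
      · simp [hw]
      · simp only [Fin.mk_one, Pi.smul_apply, smul_eq_mul]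
        field_simp
        linear_combination h

instance : T2Space CP1 := by
  refine (t2Space_iff_of_isOpenQuotientMap isOpenQuotientMap_proj).2 ?_
  simp only [proj_eq_iff_mul]
  have h1 : ∀ i, Continuous fun q : {v : Fin 2 → ℂ // v ≠ 0} × {v : Fin 2 → ℂ // v ≠ 0} =>
      (q.1 : Fin 2 → ℂ) i := fun i =>
    (continuous_apply i).comp (continuous_subtype_val.comp continuous_fst)
  have h2 : ∀ i, Continuous fun q : {v : Fin 2 → ℂ // v ≠ 0} × {v : Fin 2 → ℂ // v ≠ 0} =>
      (q.2 : Fin 2 → ℂ) i := fun i =>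
    (continuous_apply i).comp (continuous_subtype_val.comp continuous_snd)
  exact isClosed_eq ((h1 0).mul (h2 1)) ((h1 1).mul (h2 0))

lemma chart_mem_atlas (i : Fin 2) : chart i ∈ atlas ℂ CP1 := ⟨i, rfl⟩

end CP1

/-! ### The map to the projective line -/

/-- The vector `(z₁ ^ m, z₂ ^ n)`. -/
def powVec (m n : ℕ) (z : puncturedC2) : {v : Fin 2 → ℂ // v ≠ 0} :=
  ⟨![(z : C2) 0 ^ m, (z : C2) 1 ^ n], fun h => z.2 <| by
    have h0 := congrFun h 0
    have h1 := congrFun h 1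
    exact C2_ext (eq_zero_of_pow_eq_zero (by simpa using h0))
      (eq_zero_of_pow_eq_zero (by simpa using h1))⟩

lemma powRatio_eq_proj (m n : ℕ) (z : puncturedC2) :
    powRatio m n z = CP1.proj (powVec m n z) := rfl

lemma powRatio_eq_iff {m n : ℕ} {z w : puncturedC2} :
    powRatio m n z = powRatio m n w ↔
      (z : C2) 0 ^ m * (w : C2) 1 ^ n = (z : C2) 1 ^ n * (w : C2) 0 ^ m := by
  rw [powRatio_eq_proj, powRatio_eq_proj, CP1.proj_eq_iff_mul]
  simp [powVec]

lemma continuous_powRatio (m n : ℕ) : Continuous (powRatio m n) := by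
  refine CP1.isQuotientMap_proj.continuous.comp (f := powVec m n) (Continuous.subtype_mk ?_ _)
  refine continuous_pi fun i => ?_
  fin_cases i <;> simp <;> fun_prop

lemma powRatio_surjective {m n : ℕ} (hm : 0 < m) (hn : 0 < n) :
    Function.Surjective (powRatio m n) := by
  intro x
  obtain ⟨v, rfl⟩ := CP1.proj_surjective x
  obtain ⟨s, hs⟩ := IsAlgClosed.exists_pow_nat_eq ((v : Fin 2 → ℂ) 0) hm
  obtain ⟨t, ht⟩ := IsAlgClosed.exists_pow_nat_eq ((v : Fin 2 → ℂ) 1) hn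
  have hst : !₂[s, t] ∈ puncturedC2 := by
    intro h
    have h0 : s = 0 := congrArg (fun w : C2 => w 0) h
    have h1 : t = 0 := congrArg (fun w : C2 => w 1) h
    apply v.2
    ext i
    fin_cases i
    · simp [← hs, h0, hm.ne']
    · simp [← ht, h1, hn.ne']
  refine ⟨⟨!₂[s, t], hst⟩, ?_⟩
  rw [powRatio_eq_proj]
  congr 1
  ext i
  fin_cases i
  · simpa [powVec] using hs
  · simpa [powVec] using ht

instance (P : Params) : CompactSpace (S1S3 P) :=
  haveI : Fact (0 < 2 * Real.pi) := ⟨Real.two_pi_pos⟩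
  inferInstanceAs (CompactSpace (AddCircle (2 * Real.pi) × S3))

instance (P : Params) : CompactSpace (LeafSpace P) :=
  inferInstanceAs (CompactSpace (Quot (JoinedInLeaf P)))

/-! ### Arithmetic of the relations between α and β -/

/-- Since log |α| and log |β| are positive, equality of moduli forces both exponents to have the
same strict sign; if negative, the relation is inverted. -/
lemma Params.exists_pos_pow_eq (P : Params) {m₀ n₀ : ℤ} (hmn : ¬ (m₀ = 0 ∧ n₀ = 0))
    (h : P.α ^ m₀ = P.β ^ n₀) : ∃ m n : ℕ, 0 < m ∧ 0 < n ∧ P.α ^ m = P.β ^ n := by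
  have hre : m₀ * P.logα.re = n₀ * P.logβ.re := by
    have := congrArg (fun x : ℂ => Real.log ‖x‖) h
    simpa [Real.log_zpow, P.log_norm_α, P.log_norm_β] using this
  have ha := P.logα_re_pos
  have hb := P.logβ_re_pos
  rcases lt_trichotomy m₀ 0 with hm | hm | hm
  · have hm' : (m₀ : ℝ) < 0 := by exact_mod_cast hm
    have hn : n₀ < 0 := by
      have : (n₀ : ℝ) < 0 := by nlinarith
      exact_mod_cast this
    refine ⟨(-m₀).toNat, (-n₀).toNat, by omega, by omega, ?_⟩
    rw [← zpow_natCast, ← zpow_natCast, Int.toNat_of_nonneg (by omega),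
      Int.toNat_of_nonneg (by omega), zpow_neg, zpow_neg, h]
  · subst hm
    have : (n₀ : ℝ) = 0 := by
      have : (n₀ : ℝ) * P.logβ.re = 0 := by simpa using hre.symm
      exact (mul_eq_zero.1 this).resolve_right hb.ne'
    exact absurd ⟨rfl, by exact_mod_cast this⟩ hmn
  · have hm' : (0 : ℝ) < m₀ := by exact_mod_cast hm
    have hn : 0 < n₀ := by
      have : (0 : ℝ) < n₀ := by nlinarith
      exact_mod_cast this
    refine ⟨m₀.toNat, n₀.toNat, by omega, by omega, ?_⟩
    rw [← zpow_natCast, ← zpow_natCast, Int.toNat_of_nonneg hm.le,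
      Int.toNat_of_nonneg hn.le, h]

lemma Params.mul_log_re_eq (P : Params) {m n : ℕ} (h : P.α ^ m = P.β ^ n) :
    m * P.logα.re = n * P.logβ.re := by
  have := congrArg (fun x : ℂ => Real.log ‖x‖) h
  simpa [Real.log_pow, P.log_norm_α, P.log_norm_β] using this

/-- The pair `(m, n)` of positive exponents is the least one with `α ^ m = β ^ n`. -/
structure Params.IsLeastRelation (P : Params) (m n : ℕ) : Prop where
  pos_left : 0 < m
  pos_right : 0 < n
  pow_eq : P.α ^ m = P.β ^ n
  le : ∀ m' n' : ℕ, 0 < m' → 0 < n' → P.α ^ m' = P.β ^ n' → m ≤ m' ∧ n ≤ n'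

/-- It suffices to minimize m: the moduli fix the ratio m : n for every relation, so n is minimal
together with m. -/
lemma Params.exists_isLeastRelation (P : Params)
    (h : ∃ m n : ℕ, 0 < m ∧ 0 < n ∧ P.α ^ m = P.β ^ n) : ∃ m n, P.IsLeastRelation m n := by
  classical
  set m := Nat.find h
  obtain ⟨n, hm, hn, e⟩ := Nat.find_spec h
  refine ⟨m, n, hm, hn, e, fun m' n' hm' hn' e' => ?_⟩
  have hle : m ≤ m' := Nat.find_min' h ⟨n', hm', hn', e'⟩
  refine ⟨hle, ?_⟩
  have h1 := P.mul_log_re_eq e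
  have h2 := P.mul_log_re_eq e'
  have hle' : (m : ℝ) ≤ m' := by exact_mod_cast hle
  have : (n : ℝ) * P.logβ.re ≤ n' * P.logβ.re := by
    rw [← h1, ← h2]
    exact mul_le_mul_of_nonneg_right hle' P.logα_re_pos.le
  exact_mod_cast le_of_mul_le_mul_right this P.logβ_re_pos

/-- The arithmetic of the least relation `α ^ m = β ^ n`: the integer `r` with
`m log α = n log β + 2πi r` is prime to the greatest common divisor `g` of `m` and `n`. -/
lemma Params.IsLeastRelation.exists_bezout {P : Params} {m n : ℕ} (h : P.IsLeastRelation m n) :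
    ∃ r g m₁ n₁ p q c d : ℤ,
      (m * P.logα = n * P.logβ + r * (2 * Real.pi * Complex.I)) ∧
      (m : ℤ) = g * m₁ ∧ (n : ℤ) = g * n₁ ∧ p * m₁ + q * n₁ = 1 ∧ c * g + d * r = 1 := by
  obtain ⟨r, hr⟩ : ∃ r : ℤ, m * P.logα = n * P.logβ + r * (2 * Real.pi * Complex.I) := by
    rw [← Complex.exp_eq_exp_iff_exists_int, Complex.exp_nat_mul, Complex.exp_nat_mul,
      P.exp_logα, P.exp_logβ, h.pow_eq]
  obtain ⟨hm, hn⟩ := And.intro h.pos_left h.pos_right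
  set g := Nat.gcd m n
  have hg : 0 < g := Nat.gcd_pos_of_pos_left n hm
  obtain ⟨m₁, n₁, hcop, e1, e2⟩ := Nat.exists_coprime m n
  obtain ⟨p, q, hpq⟩ := Nat.isCoprime_iff_coprime.2 hcop
  have hgr : IsCoprime (g : ℤ) r := by
    rw [Int.isCoprime_iff_gcd_eq_one]
    set D := Int.gcd g r
    -- A common divisor D of g and r divides the whole relation m log α = n log β + 2πi r. The
    -- quotient exponentiates to a relation with exponents m/D and n/D, so minimality forces D = 1.
    obtain ⟨g', hg'⟩ : D ∣ g := by exact_mod_cast Int.gcd_dvd_left (g : ℤ) r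
    obtain ⟨r', hr'⟩ : (D : ℤ) ∣ r := Int.gcd_dvd_right (g : ℤ) r
    have hD : 0 < D := Nat.pos_of_ne_zero fun h0 => by rw [h0] at hg'; omega
    have em : m = D * (g' * m₁) := by rw [e1, show Nat.gcd m n = g from rfl, hg']; ring
    have en : n = D * (g' * n₁) := by rw [e2, show Nat.gcd m n = g from rfl, hg']; ring
    have hD0 : (D : ℂ) ≠ 0 := by exact_mod_cast hD.ne'
    have hrel : ((g' * m₁ : ℕ) : ℂ) * P.logα
        = (g' * n₁ : ℕ) * P.logβ + r' * (2 * Real.pi * Complex.I) := by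
      apply mul_left_cancel₀ hD0
      have hr2 := hr
      rw [em, en, hr'] at hr2
      push_cast at hr2 ⊢
      linear_combination hr2
    have hpow : P.α ^ (g' * m₁) = P.β ^ (g' * n₁) := by
      rw [← P.exp_logα, ← P.exp_logβ, ← Complex.exp_nat_mul, ← Complex.exp_nat_mul,
        Complex.exp_eq_exp_iff_exists_int]
      exact ⟨r', hrel⟩
    have hm' : 0 < g' * m₁ := Nat.pos_of_ne_zero fun h0 => by rw [h0] at em; omega
    have hn' : 0 < g' * n₁ := Nat.pos_of_ne_zero fun h0 => by rw [h0] at en; omega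
    have hle := (h.le _ _ hm' hn' hpow).1
    rw [em] at hle
    by_contra hD1
    have : 2 ≤ D := by omega
    nlinarith
  obtain ⟨c, d, hcd⟩ := hgr
  exact ⟨r, g, m₁, n₁, p, q, c, d, hr, by rw [mul_comm]; exact_mod_cast e1,
    by rw [mul_comm]; exact_mod_cast e2, hpq, hcd⟩

/-! ### Invariance of the map and its fibres -/

lemma powRatio_deck {P : Params} {m n : ℕ} (h : P.α ^ m = P.β ^ n) (k : ℤ) (z : puncturedC2) :
    powRatio m n (deck P k z) = powRatio m n z := by
  have : (P.α ^ k) ^ m = (P.β ^ k) ^ n := by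
    rw [← zpow_natCast, ← zpow_natCast, zpow_comm, zpow_natCast, h, ← zpow_natCast, zpow_comm]
  rw [powRatio_eq_iff]
  simp only [deck, diag_zero_coord, diag_one_coord, mul_pow, this]
  ring

/-- The flow only involves the moduli of α and β, so m log |α| = n log |β| is all that is used. -/
lemma powRatio_flow {P : Params} {m n : ℕ} (h : P.α ^ m = P.β ^ n) (u : ℂ) (z : puncturedC2) :
    powRatio m n (flow P u z) = powRatio m n z := by
  have : (Complex.exp (u * P.logα.re)) ^ m = (Complex.exp (u * P.logβ.re)) ^ n := by
    rw [← Complex.exp_nat_mul, ← Complex.exp_nat_mul]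
    congr 1
    have := congrArg (fun x : ℝ => (x : ℂ)) (P.mul_log_re_eq h)
    push_cast at this
    linear_combination u * this
  rw [powRatio_eq_iff]
  simp only [flow, diag_zero_coord, diag_one_coord, mul_pow, this]
  ring

lemma exp_log_zpow (c : ℂ) (k : ℤ) : Complex.exp c ^ k = Complex.exp (k * c) :=
  (Complex.exp_int_mul c k).symm

lemma Params.logα_re_ne_zero (P : Params) : (P.logα.re : ℂ) ≠ 0 :=
  Complex.ofReal_ne_zero.2 P.logα_re_pos.ne'

lemma Params.logβ_re_ne_zero (P : Params) : (P.logβ.re : ℂ) ≠ 0 :=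
  Complex.ofReal_ne_zero.2 P.logβ_re_pos.ne'

/-- Two pairs `(1, 1)` and `(x, y)` with `x ^ m = y ^ n` are related by the flow and by the
deck transformations. -/
lemma Params.IsLeastRelation.exists_exp_eq {P : Params} {m n : ℕ} (h : P.IsLeastRelation m n)
    {x y : ℂ} (hx : x ≠ 0) (hy : y ≠ 0) (hxy : x ^ m = y ^ n) :
    ∃ (k : ℤ) (u : ℂ), x = P.α ^ k * Complex.exp (u * P.logα.re) ∧
      y = P.β ^ k * Complex.exp (u * P.logβ.re) := by
  obtain ⟨r, g, m₁, n₁, p, q, c, d, hr, em, en, hpq, hcd⟩ := h.exists_bezout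
  have hn : (n : ℂ) ≠ 0 := by exact_mod_cast h.pos_right.ne'
  have hab := congrArg (fun x : ℝ => (x : ℂ)) (P.mul_log_re_eq h.pow_eq)
  push_cast at hab
  obtain ⟨s, hs⟩ : ∃ s : ℤ,
      m * Complex.log x = n * Complex.log y + s * (2 * Real.pi * Complex.I) := by
    rw [← Complex.exp_eq_exp_iff_exists_int, Complex.exp_nat_mul, Complex.exp_nat_mul,
      Complex.exp_log hx, Complex.exp_log hy, hxy]
  have hbez : c * p * m + c * q * n + d * r = 1 := by
    rw [em, en, ← hcd]
    linear_combination c * g * hpq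
  have ha := P.logα_re_ne_zero
  -- With branches log x + 2πi l and log y + 2πi j, the two equations determine u consistently
  -- exactly when s + m l - k r = n j. The values of k, l, j are s times the coefficients of the
  -- Bézout identity `hbez`.
  set k : ℤ := s * d
  set l : ℤ := -(s * c * p)
  set j : ℤ := s * c * q
  have hlj : s + m * l - k * r = n * j := by
    simp only [k, l, j]
    linear_combination -s * hbez
  have hlj' : (s + m * l - k * r : ℂ) = n * j := by exact_mod_cast hlj
  set u : ℂ := (Complex.log x + l * (2 * Real.pi * Complex.I) - k * P.logα) / P.logα.re
  have hua : u * P.logα.re = Complex.log x + l * (2 * Real.pi * Complex.I) - k * P.logα :=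
    div_mul_cancel₀ _ ha
  have hub : k * P.logβ + u * P.logβ.re = Complex.log y + j * (2 * Real.pi * Complex.I) := by
    apply mul_left_cancel₀ hn
    linear_combination (-u) * hab + (m : ℂ) * hua + hs - k * hr +
      (2 * Real.pi * Complex.I) * hlj'
  refine ⟨k, u, ?_, ?_⟩
  · rw [← P.exp_logα, exp_log_zpow, ← Complex.exp_add, hua]
    rw [add_sub_cancel, Complex.exp_add, Complex.exp_int_mul_two_pi_mul_I, mul_one,
      Complex.exp_log hx]
  · rw [← P.exp_logβ, exp_log_zpow, ← Complex.exp_add, hub, Complex.exp_add,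
      Complex.exp_int_mul_two_pi_mul_I, mul_one, Complex.exp_log hy]

/-- Off the axes the coordinate ratios x = w₁/z₁ and y = w₂/z₂ satisfy x^m = y^n, which is the case
of `exists_exp_eq`. On an axis only one equation remains, and the flow alone solves it. -/
lemma Params.IsLeastRelation.exists_flow_of_powRatio_eq {P : Params} {m n : ℕ}
    (h : P.IsLeastRelation m n) {z w : puncturedC2} (hzw : powRatio m n z = powRatio m n w) :
    ∃ (k : ℤ) (u : ℂ), w = deck P k (flow P u z) := by
  rw [powRatio_eq_iff] at hzw
  have hm := h.pos_left.ne'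
  have hn := h.pos_right.ne'
  have ne : ∀ v : puncturedC2, (v : C2) 0 = 0 → (v : C2) 1 ≠ 0 := fun v h0 h1 =>
    v.2 (C2_ext (by simpa using h0) (by simpa using h1))
  suffices H : ∃ (k : ℤ) (u : ℂ), (w : C2) 0 = P.α ^ k * (Complex.exp (u * P.logα.re) * (z : C2) 0)
      ∧ (w : C2) 1 = P.β ^ k * (Complex.exp (u * P.logβ.re) * (z : C2) 1) by
    obtain ⟨k, u, h0, h1⟩ := H
    exact ⟨k, u, Subtype.ext (C2_ext (by simp [deck, flow, h0]) (by simp [deck, flow, h1]))⟩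
  by_cases hz0 : (z : C2) 0 = 0
  · have hz1 := ne z hz0
    have hw0 : (w : C2) 0 = 0 := by simpa [hz0, hm, hz1] using hzw
    have hw1 := ne w hw0
    refine ⟨0, Complex.log ((w : C2) 1 / (z : C2) 1) / P.logβ.re, by simp [hz0, hw0], ?_⟩
    rw [div_mul_cancel₀ _ P.logβ_re_ne_zero, Complex.exp_log (div_ne_zero hw1 hz1)]
    simp [hz1]
  · by_cases hz1 : (z : C2) 1 = 0
    · have hw1 : (w : C2) 1 = 0 := by simpa [hz1, hn, hz0] using hzw
      have hw0 : (w : C2) 0 ≠ 0 := fun h0 => ne w h0 hw1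
      refine ⟨0, Complex.log ((w : C2) 0 / (z : C2) 0) / P.logα.re, ?_, by simp [hz1, hw1]⟩
      rw [div_mul_cancel₀ _ P.logα_re_ne_zero, Complex.exp_log (div_ne_zero hw0 hz0)]
      simp [hz0]
    · have hw0 : (w : C2) 0 ≠ 0 := fun h0 => by
        have := ne w h0
        simp [h0, hm, hz0, this] at hzw
      have hw1 : (w : C2) 1 ≠ 0 := fun h1 => by
        simp [h1, hn, hz1, hw0] at hzw
      obtain ⟨k, u, hx, hy⟩ := h.exists_exp_eq (div_ne_zero hw0 hz0) (div_ne_zero hw1 hz1) (by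
        rw [div_pow, div_pow, div_eq_div_iff (pow_ne_zero _ hz0) (pow_ne_zero _ hz1)]
        linear_combination -hzw)
      refine ⟨k, u, ?_, ?_⟩
      · rw [← mul_assoc, ← hx, div_mul_cancel₀ _ hz0]
      · rw [← mul_assoc, ← hy, div_mul_cancel₀ _ hz1]

/-! ### Period lattices of the leaves -/

/-- A pair of periods, the first one purely imaginary and the second one not. -/
def periodPair (ω₁ ω₂ : ℂ) (h₁ : ω₁.re = 0) (h₁' : ω₁ ≠ 0) (h₂ : ω₂.re ≠ 0) : PeriodPair where
  ω₁ := ω₁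
  ω₂ := ω₂
  indep := by
    rw [LinearIndependent.pair_iff]
    intro s t h
    have hre := congrArg Complex.re h
    simp [h₁, h₂] at hre
    subst hre
    simpa [h₁'] using h

lemma exp_mul_eq_zpow_iff (u a c : ℂ) (k : ℤ) :
    Complex.exp (u * a) = Complex.exp c ^ k ↔
      ∃ l : ℤ, u * a = k * c + l * (2 * Real.pi * Complex.I) := by
  rw [exp_log_zpow, Complex.exp_eq_exp_iff_exists_int]

/-- The return times of the one-dimensional flow `u ↦ exp (u Re c)` to the orbit of `1` under
multiplication by `exp c` form a lattice. -/
lemma exists_periodPair_of_axis (c : ℂ) (hc : 0 < c.re) :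
    ∃ L : PeriodPair, ∀ u, u ∈ L.lattice ↔
      ∃ k : ℤ, Complex.exp (u * c.re) = Complex.exp c ^ k := by
  have hc' : (c.re : ℂ) ≠ 0 := Complex.ofReal_ne_zero.2 hc.ne'
  -- The condition is u Re c = k c + 2πi l; the generators correspond to (k, l) = (0, 1) and (1, 0).
  refine ⟨periodPair (2 * Real.pi * Complex.I / c.re) (c / c.re) ?_ ?_ ?_, fun u => ?_⟩
  · simp [Complex.div_ofReal_re]
  · exact div_ne_zero Complex.two_pi_I_ne_zero hc'
  · simp [Complex.div_ofReal_re, hc.ne']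
  · simp only [PeriodPair.mem_lattice, periodPair, exp_mul_eq_zpow_iff]
    constructor
    · rintro ⟨l, k, rfl⟩
      exact ⟨k, l, by field_simp; ring⟩
    · rintro ⟨k, l, h⟩
      refine ⟨l, k, mul_right_cancel₀ hc' ?_⟩
      rw [h]
      field_simp
      ring

/-- The return times of a point off the axes are parametrized by the integer pairs (k, l) with n ∣ k
r + l m, a rank two group for which a basis is computed. -/
lemma Params.IsLeastRelation.exists_periodPair {P : Params} {m n : ℕ}
    (h : P.IsLeastRelation m n) :
    ∃ L : PeriodPair, ∀ u, u ∈ L.lattice ↔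
      ∃ k : ℤ, Complex.exp (u * P.logα.re) = P.α ^ k ∧
        Complex.exp (u * P.logβ.re) = P.β ^ k := by
  obtain ⟨r, g, m₁, n₁, p, q, c, d, hr, em, en, hpq, hcd⟩ := h.exists_bezout
  have hn : (n : ℤ) ≠ 0 := by exact_mod_cast h.pos_right.ne'
  have hnC : (n : ℂ) ≠ 0 := by exact_mod_cast h.pos_right.ne'
  have hg : g ≠ 0 := fun h0 => hn (by rw [en, h0, zero_mul])
  have hn₁ : n₁ ≠ 0 := fun h0 => hn (by rw [en, h0, mul_zero])
  have ha := P.logα_re_ne_zero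
  have hab := congrArg (fun x : ℝ => (x : ℂ)) (P.mul_log_re_eq h.pow_eq)
  push_cast at hab
  -- The first equation gives u log |α| = k log α + 2πi l. Multiplying by m and using m log α = n
  -- log β + 2πi r, the second equation becomes the divisibility of k r + l m by n.
  have hmem : ∀ u, (∃ k : ℤ, Complex.exp (u * P.logα.re) = P.α ^ k ∧
      Complex.exp (u * P.logβ.re) = P.β ^ k) ↔
      ∃ k l : ℤ, u * P.logα.re = k * P.logα + l * (2 * Real.pi * Complex.I) ∧
        ∃ j : ℤ, k * r + l * m = j * n := by
    intro u
    simp only [← P.exp_logα, ← P.exp_logβ, exp_mul_eq_zpow_iff]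
    refine exists_congr fun k => ?_
    constructor
    · rintro ⟨⟨l, hl⟩, j, hj⟩
      refine ⟨l, hl, j, ?_⟩
      have : (k * r + l * m : ℂ) * (2 * Real.pi * Complex.I)
          = (j * n) * (2 * Real.pi * Complex.I) := by
        linear_combination u * hab - m * hl + n * hj - k * hr
      exact_mod_cast mul_right_cancel₀ Complex.two_pi_I_ne_zero this
    · rintro ⟨l, hl, j, hj⟩
      have hj' : (k * r + l * m : ℂ) = j * n := by exact_mod_cast hj
      refine ⟨⟨l, hl⟩, j, mul_left_cancel₀ hnC ?_⟩
      linear_combination (-u) * hab + m * hl + k * hr + (2 * Real.pi * Complex.I) * hj'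
  -- As p inverts m₁ modulo n₁, this l₀ solves r + l m₁ ≡ 0 mod n₁. The basis is (k, l) = (0, n₁)
  -- and (g, l₀).
  set l₀ : ℤ := -(r * p)
  have hl₀ : r + l₀ * m₁ = r * q * n₁ := by
    simp only [l₀]
    linear_combination -r * hpq
  refine ⟨periodPair (n₁ * (2 * Real.pi * Complex.I) / P.logα.re)
    ((g * P.logα + l₀ * (2 * Real.pi * Complex.I)) / P.logα.re) ?_ ?_ ?_, fun u => ?_⟩
  · simp [Complex.div_ofReal_re]
  · exact div_ne_zero (mul_ne_zero (by exact_mod_cast hn₁) Complex.two_pi_I_ne_zero) ha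
  · simp [Complex.div_ofReal_re, P.logα_re_pos.ne', hg]
  · rw [hmem]
    simp only [PeriodPair.mem_lattice, periodPair]
    constructor
    · rintro ⟨s, t, rfl⟩
      refine ⟨t * g, s * n₁ + t * l₀, ?_, s * m₁ + t * (r * q), ?_⟩
      · push_cast
        field_simp
        ring
      · rw [em, en]
        linear_combination t * g * hl₀
    -- From k r + l m = j n, g divides k r, hence k, being prime to r. After division by g, n₁
    -- divides m₁ (l - t l₀), hence l - t l₀.
    · rintro ⟨k, l, hu, j, hj⟩
      obtain ⟨t, rfl⟩ : g ∣ k := by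
        refine ⟨k * c + d * (j * n₁ - l * m₁), ?_⟩
        rw [em, en] at hj
        linear_combination (-k) * hcd + d * hj
      have hj' : t * r + l * m₁ = j * n₁ := by
        apply mul_left_cancel₀ hg
        rw [em, en] at hj
        linear_combination hj
      obtain ⟨s, hs⟩ : n₁ ∣ l - t * l₀ := by
        refine ⟨(l - t * l₀) * q + p * (j - t * (r * q)), ?_⟩
        linear_combination (-(l - t * l₀)) * hpq + p * hj' - p * t * hl₀
      have hs' : (l - t * l₀ : ℂ) = n₁ * s := by exact_mod_cast hs
      refine ⟨s, t, mul_right_cancel₀ ha ?_⟩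
      rw [hu]
      push_cast
      field_simp
      linear_combination (-(2 * Real.pi * Complex.I)) * hs'

/-- The return times of the flow to the orbit of a point under the deck transformations form
a lattice. -/
lemma Params.IsLeastRelation.exists_periodPair_flow {P : Params} {m n : ℕ}
    (h : P.IsLeastRelation m n) (z : puncturedC2) :
    ∃ L : PeriodPair, ∀ u, u ∈ L.lattice ↔ ∃ k : ℤ, flow P u z = deck P k z := by
  -- A vanishing coordinate imposes no condition, so the lattice on an axis may be finer than the
  -- generic one: those leaves are treated by `exists_periodPair_of_axis`.
  have key : ∀ (u : ℂ) (k : ℤ), flow P u z = deck P k z ↔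
      (Complex.exp (u * P.logα.re) = P.α ^ k ∨ (z : C2) 0 = 0) ∧
        (Complex.exp (u * P.logβ.re) = P.β ^ k ∨ (z : C2) 1 = 0) := by
    intro u k
    rw [← mul_eq_mul_right_iff, ← mul_eq_mul_right_iff]
    constructor
    · intro e
      have e' := congrArg Subtype.val e
      exact ⟨by simpa [flow, deck] using congrArg (fun w : C2 => w 0) e',
        by simpa [flow, deck] using congrArg (fun w : C2 => w 1) e'⟩
    · rintro ⟨h0, h1⟩
      exact Subtype.ext (C2_ext (by simpa [flow, deck] using h0) (by simpa [flow, deck] using h1))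
  simp only [key]
  by_cases hz0 : (z : C2) 0 = 0
  · have hz1 : (z : C2) 1 ≠ 0 := fun h1 => z.2 (C2_ext (by simpa using hz0) (by simpa using h1))
    simpa [hz0, hz1, P.exp_logβ] using exists_periodPair_of_axis _ P.logβ_re_pos
  · by_cases hz1 : (z : C2) 1 = 0
    · simpa [hz0, hz1, P.exp_logα] using exists_periodPair_of_axis _ P.logα_re_pos
    · simpa [hz0, hz1] using h.exists_periodPair

/-! ### Holomorphy of the fibration and of the leaf parametrizations -/

/-- The charts of `S¹ × S³` are local inverses of the projection `ℂ² ∖ 0 → S¹ × S³`. -/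
lemma toS1S3_chartAt {P : Params} (p : S1S3 P) {x : S1S3 P} (hx : x ∈ (chartAt C2 p).source) :
    ∃ h : chartAt C2 p x ∈ puncturedC2, toS1S3 P ⟨chartAt C2 p x, h⟩ = x := by
  set H := (F P).symm.isLocalHomeomorph
  set H' := isLocalHomeomorph_toSurface P
  set y : Surface P := (F P).symm.surjective.hasRightInverse.choose p
  set z : puncturedC2 := (toSurface_surjective P).hasRightInverse.choose y
  have hx' : x ∈ ((H.localInverseAt y).trans ((H'.localInverseAt z).trans (chartAt C2 z))).source :=
    hx
  have h1 : x ∈ (H.localInverseAt y).source := hx'.1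
  have h2 : H.localInverseAt y x ∈ (H'.localInverseAt z).source := hx'.2.1
  have h3 : chartAt C2 p x = (H'.localInverseAt z (H.localInverseAt y x) : C2) := rfl
  refine ⟨h3 ▸ Subtype.prop _, ?_⟩
  simp only [h3, Subtype.coe_eta, toS1S3]
  rw [H'.apply_localInverseAt_of_mem h2, H.apply_localInverseAt_of_mem h1]

lemma chartAt_symm_eq_toS1S3 {P : Params} (p : S1S3 P) {z : puncturedC2}
    (hz : (z : C2) ∈ (chartAt C2 p).target) : (chartAt C2 p).symm z = toS1S3 P z := by
  obtain ⟨h, e⟩ := toS1S3_chartAt p ((chartAt C2 p).map_target hz)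
  rw [← e]
  congr 1
  exact Subtype.ext ((chartAt C2 p).right_inv hz)

/-- Near z some coordinate i does not vanish, and there f is the inverse of the i-th affine chart
composed with a quotient of monomials. The value of f at 0 plays no role. -/
lemma mdifferentiableAt_of_comp_val {f : C2 → CP1} {m n : ℕ}
    (hf : ∀ z : puncturedC2, f z = powRatio m n z) (z : puncturedC2) :
    MDifferentiableAt 𝓘(ℂ, C2) 𝓘(ℂ) f z := by
  set k : Fin 2 → ℕ := ![m, n]
  have hk : ∀ (w : puncturedC2) i, (powVec m n w : Fin 2 → ℂ) i = (w : C2) i ^ k i := by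
    intro w i
    fin_cases i <;> rfl
  obtain ⟨i, hi⟩ : ∃ i, (z : C2) i ≠ 0 := by
    by_contra! h
    exact z.2 (C2_ext (by simpa using h 0) (by simpa using h 1))
  set q : C2 → ℂ := fun w => w (1 - i) ^ k (1 - i) / w i ^ k i
  have hq : DifferentiableAt ℂ q z := by
    have hc : ∀ j, DifferentiableAt ℂ (fun w : C2 => w j) z := fun j => by fun_prop
    have hp : ∀ j, DifferentiableAt ℂ (fun w : C2 => w j ^ k j) z := fun j => (hc j).fun_pow _
    simp only [q, div_eq_mul_inv]
    exact (hp (1 - i)).fun_mul ((hp i).fun_inv (pow_ne_zero _ hi))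
  have hs : MDifferentiableAt 𝓘(ℂ) 𝓘(ℂ) (CP1.chart i).symm (q z) :=
    mdifferentiableAt_atlas_symm (CP1.chart_mem_atlas i) (Set.mem_univ _)
  refine (hs.comp _ hq.mdifferentiableAt).congr_of_eventuallyEq ?_
  have hopen : IsOpen {w : C2 | w i ≠ 0} := isOpen_ne_fun (by fun_prop) continuous_const
  filter_upwards [hopen.mem_nhds hi] with w hw
  have hw0 : w ∈ puncturedC2 := by
    rintro rfl
    exact hw rfl
  have hmem : powRatio m n ⟨w, hw0⟩ ∈ (CP1.chart i).source :=
    ⟨powVec m n ⟨w, hw0⟩, by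
      show (powVec m n ⟨w, hw0⟩ : Fin 2 → ℂ) i ≠ 0
      rw [hk]
      exact pow_ne_zero _ hw, rfl⟩
  rw [hf ⟨w, hw0⟩, Function.comp_apply, ← (CP1.chart i).left_inv hmem]
  congr 1
  show CP1.coord i (CP1.proj (powVec m n ⟨w, hw0⟩)) = _
  rw [CP1.coord_proj, hk, hk]

/-- A map of `S¹ × S³` to `ℂP¹` that is induced by `(z₁, z₂) ↦ [z₁ ^ m : z₂ ^ n]` is
holomorphic. -/
lemma mdifferentiable_of_comp_toS1S3 {P : Params} {f : S1S3 P → CP1} {m n : ℕ}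
    (hf : ∀ z, f (toS1S3 P z) = powRatio m n z) : MDifferentiable 𝓘(ℂ, C2) 𝓘(ℂ) f := by
  classical
  intro p
  -- An extension to all of ℂ², so that it can be composed with the chart; the value at the origin
  -- is arbitrary.
  set G : C2 → CP1 := fun w => if h : w ∈ puncturedC2 then powRatio m n ⟨w, h⟩ else f p
  have hG : ∀ z : puncturedC2, G z = powRatio m n z := fun z => dif_pos z.2
  obtain ⟨h, -⟩ := toS1S3_chartAt p (mem_chart_source C2 p)
  have h1 : MDifferentiableAt 𝓘(ℂ, C2) 𝓘(ℂ) G (chartAt C2 p p) :=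
    mdifferentiableAt_of_comp_val hG ⟨_, h⟩
  have h2 : MDifferentiableAt 𝓘(ℂ, C2) 𝓘(ℂ, C2) (chartAt C2 p) p :=
    mdifferentiableAt_atlas (chart_mem_atlas C2 p) (mem_chart_source C2 p)
  refine (h1.comp p h2).congr_of_eventuallyEq ?_
  filter_upwards [chart_source_mem_nhds C2 p] with x hx
  obtain ⟨h', e⟩ := toS1S3_chartAt p hx
  rw [Function.comp_apply, hG ⟨_, h'⟩, ← hf, e]

/-- The orbits of the flow, lifted to `ℂ² ∖ 0`, are immersed. -/
lemma differentiable_deck_flow (P : Params) (k : ℤ) (z : puncturedC2) :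
    Differentiable ℂ (fun u => (deck P k (flow P u z) : C2)) ∧
      ∀ u, Function.Injective (fderiv ℂ (fun u => (deck P k (flow P u z) : C2)) u) := by
  set g : ℂ → C2 := fun u => (deck P k (flow P u z) : C2)
  have hg0 : (fun u => g u 0) = fun u => P.α ^ k * (Complex.exp (u * P.logα.re) * (z : C2) 0) := by
    ext u; simp [g, deck, flow]
  have hg1 : (fun u => g u 1) = fun u => P.β ^ k * (Complex.exp (u * P.logβ.re) * (z : C2) 1) := by
    ext u; simp [g, deck, flow]
  have hexp : ∀ (A c x u : ℂ), HasDerivAt (fun u => A * (Complex.exp (u * c) * x))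
      (A * (Complex.exp (u * c) * c * x)) u := by
    intro A c x u
    exact (((hasDerivAt_mul_const c).cexp.mul_const x).const_mul A)
  have hd : Differentiable ℂ g := by
    rw [differentiable_euclidean]
    intro i
    fin_cases i
    · show Differentiable ℂ (fun u => g u 0)
      rw [hg0]
      exact fun u => (hexp _ _ _ u).differentiableAt
    · show Differentiable ℂ (fun u => g u 1)
      rw [hg1]
      exact fun u => (hexp _ _ _ u).differentiableAt
  refine ⟨hd, fun u => ?_⟩
  -- The components of the derivative are nonzero multiples of the coordinates of z, because log |α|
  -- and log |β| are nonzero; they cannot both vanish.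
  have hne : deriv g u ≠ 0 := by
    intro h0
    have hD : HasDerivAt g 0 u := h0 ▸ (hd u).hasDerivAt
    have hi : ∀ i, HasDerivAt (fun u => g u i) 0 u := fun i =>
      (PiLp.proj (𝕜 := ℂ) 2 (fun _ : Fin 2 => ℂ) i).hasFDerivAt.comp_hasDerivAt u hD
    have e0 := hi 0
    have e1 := hi 1
    rw [hg0] at e0
    rw [hg1] at e1
    have z0 := e0.unique (hexp _ _ _ u)
    have z1 := e1.unique (hexp _ _ _ u)
    apply z.2
    refine C2_ext ?_ ?_
    · simpa [zpow_ne_zero, P.α_ne_zero, P.logα_re_pos.ne'] using z0.symm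
    · simpa [zpow_ne_zero, P.β_ne_zero, P.logβ_re_pos.ne'] using z1.symm
  rw [injective_iff_map_eq_zero]
  intro v hv
  have : v • deriv g u = 0 := by
    rw [← hv, ← fderiv_apply_one_eq_deriv, ← map_smul, smul_eq_mul, mul_one]
  exact (smul_eq_zero.1 this).resolve_right hne

/-- The orbits of the flow in `S¹ × S³` are immersed holomorphic curves. -/
lemma mdifferentiableAt_toS1S3_flow (P : Params) (z : puncturedC2) (u : ℂ) :
    MDifferentiableAt 𝓘(ℂ) 𝓘(ℂ, C2) (fun u => toS1S3 P (flow P u z)) u ∧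
      Function.Injective (mfderiv 𝓘(ℂ) 𝓘(ℂ, C2) (fun u => toS1S3 P (flow P u z)) u) := by
  set φ : ℂ → S1S3 P := fun u => toS1S3 P (flow P u z)
  set e := chartAt C2 (φ u)
  have hsrc : φ u ∈ e.source := mem_chart_source C2 (φ u)
  obtain ⟨h, he⟩ := toS1S3_chartAt (φ u) hsrc
  -- The chart picks one lift of φ u, which is the k-th deck translate of the flow lift; continuity
  -- keeps the same k valid near u.
  obtain ⟨k, hk⟩ := toS1S3_eq_iff.1 he.symm
  set g : ℂ → C2 := fun u => (deck P k (flow P u z) : C2)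
  obtain ⟨hd, hinj⟩ := differentiable_deck_flow P k z
  have hgu : g u = e (φ u) := (congrArg Subtype.val hk).symm
  have hmem : ∀ᶠ v in 𝓝 u, g v ∈ e.target := by
    refine hd.continuous.continuousAt.eventually (e.open_target.mem_nhds ?_)
    change g u ∈ e.target
    exact hgu ▸ e.map_source hsrc
  have hφ : φ =ᶠ[𝓝 u] e.symm ∘ g := by
    filter_upwards [hmem] with v hv
    rw [Function.comp_apply, chartAt_symm_eq_toS1S3 (φ u) hv, toS1S3_deck]
  have hgφ : e ∘ φ =ᶠ[𝓝 u] g := by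
    filter_upwards [hmem, hφ] with v hv hv'
    rw [Function.comp_apply, hv', Function.comp_apply, e.right_inv hv]
  have hes : MDifferentiableAt 𝓘(ℂ, C2) 𝓘(ℂ, C2) e.symm (g u) :=
    mdifferentiableAt_atlas_symm (chart_mem_atlas C2 (φ u)) (hgu ▸ e.map_source hsrc)
  have hMφ : MDifferentiableAt 𝓘(ℂ) 𝓘(ℂ, C2) φ u :=
    (hes.comp u (hd u).mdifferentiableAt).congr_of_eventuallyEq hφ
  refine ⟨hMφ, ?_⟩
  have hMe : MDifferentiableAt 𝓘(ℂ, C2) 𝓘(ℂ, C2) e (φ u) :=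
    mdifferentiableAt_atlas (chart_mem_atlas C2 (φ u)) hsrc
  have hcomp := mfderiv_comp u hMe hMφ
  -- By the chain rule the injective derivative of g factors through that of φ, which is therefore
  -- injective.
  rw [hgφ.mfderiv_eq, mfderiv_eq_fderiv] at hcomp
  have hi := hinj u
  intro v w hvw
  apply hi
  have := congrArg (mfderiv 𝓘(ℂ, C2) 𝓘(ℂ, C2) e (φ u)) hvw
  exact (DFunLike.congr_fun hcomp v).trans (this.trans (DFunLike.congr_fun hcomp w).symm)

/-! ### The leaf space and the homeomorphism with the projective line -/

lemma leafProj_flow (P : Params) (u : ℂ) (z : puncturedC2) :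
    leafProj P (toS1S3 P (flow P u z)) = leafProj P (toS1S3 P z) :=
  (Quot.sound (joinedInLeaf_flow P u z)).symm

/-- The map `S¹ × S³ → ℂP¹` induced by `(z₁, z₂) ↦ [z₁ ^ m : z₂ ^ n]`. -/
def fibration (P : Params) {m n : ℕ} (h : P.α ^ m = P.β ^ n) (p : S1S3 P) : CP1 :=
  Quotient.lift (s := hopfSetoid P) (powRatio m n) (by
    rintro z w ⟨k, hk⟩
    have : w = deck P k z := Subtype.ext hk
    rw [this, powRatio_deck h]) (F P p)

lemma fibration_of_F_eq {P : Params} {m n : ℕ} (h : P.α ^ m = P.β ^ n) {p : S1S3 P}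
    {z : puncturedC2} (hp : F P p = toSurface P z) : fibration P h p = powRatio m n z := by
  rw [fibration, hp]
  rfl

lemma fibration_toS1S3 {P : Params} {m n : ℕ} (h : P.α ^ m = P.β ^ n) (z : puncturedC2) :
    fibration P h (toS1S3 P z) = powRatio m n z :=
  fibration_of_F_eq h (F_toS1S3 P z)

lemma continuous_fibration {P : Params} {m n : ℕ} (h : P.α ^ m = P.β ^ n) :
    Continuous (fibration P h) :=
  (Continuous.quotient_lift (continuous_powRatio m n) _).comp (F P).continuous

/-- The map `Δ → ℂP¹` induced by `(z₁, z₂) ↦ [z₁ ^ m : z₂ ^ n]`. -/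
def leafMap (P : Params) {m n : ℕ} (h : P.α ^ m = P.β ^ n) : LeafSpace P → CP1 :=
  Quot.lift (fibration P h) fun p q hpq => by
    obtain ⟨u, z, rfl, rfl⟩ := hpq.exists_flow
    rw [fibration_toS1S3, fibration_toS1S3, powRatio_flow h]

lemma leafMap_leafProj {P : Params} {m n : ℕ} (h : P.α ^ m = P.β ^ n) (p : S1S3 P) :
    leafMap P h (leafProj P p) = fibration P h p := rfl

lemma leafProj_eq_of_powRatio_eq {P : Params} {m n : ℕ} (h : P.IsLeastRelation m n)
    {z w : puncturedC2} (hzw : powRatio m n z = powRatio m n w) :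
    leafProj P (toS1S3 P z) = leafProj P (toS1S3 P w) := by
  obtain ⟨k, u, rfl⟩ := h.exists_flow_of_powRatio_eq hzw
  rw [toS1S3_deck, leafProj_flow]

lemma leafMap_bijective {P : Params} {m n : ℕ} (h : P.IsLeastRelation m n) :
    Function.Bijective (leafMap P h.pow_eq) := by
  constructor
  · intro x y
    obtain ⟨p, rfl⟩ := Quot.exists_rep x
    obtain ⟨q, rfl⟩ := Quot.exists_rep y
    obtain ⟨z, rfl⟩ := toS1S3_surjective P p
    obtain ⟨w, rfl⟩ := toS1S3_surjective P q
    intro e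
    change fibration P h.pow_eq (toS1S3 P z) = fibration P h.pow_eq (toS1S3 P w) at e
    rw [fibration_toS1S3, fibration_toS1S3] at e
    exact leafProj_eq_of_powRatio_eq h e
  · intro x
    obtain ⟨z, rfl⟩ := powRatio_surjective h.pos_left h.pos_right x
    exact ⟨leafProj P (toS1S3 P z), fibration_toS1S3 h.pow_eq z⟩

/-- The homeomorphism `Δ → ℂP¹` induced by `(z₁, z₂) ↦ [z₁ ^ m : z₂ ^ n]`. -/
def leafHomeomorph (P : Params) {m n : ℕ} (h : P.IsLeastRelation m n) : LeafSpace P ≃ₜ CP1 :=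
  -- The leaf space is compact as a quotient of S¹ × S³, and the projective line is Hausdorff.
  Continuous.homeoOfEquivCompactToT2 (f := Equiv.ofBijective _ (leafMap_bijective h))
    (continuous_quot_lift _ (continuous_fibration h.pow_eq))

/-- The leaves are the orbits of the flow. -/
lemma leafProj_eq_iff {P : Params} {m n : ℕ} (h : P.IsLeastRelation m n) {p : S1S3 P}
    {z : puncturedC2} :
    leafProj P p = leafProj P (toS1S3 P z) ↔ ∃ u, toS1S3 P (flow P u z) = p := by
  constructor
  · intro e
    obtain ⟨w, rfl⟩ := toS1S3_surjective P p
    -- Equality in the leaf space is only a chain of tangent curves; passing to `powRatio`, whose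
    -- fibres are single orbits up to deck transformations, replaces the chain by one flow time.
    have e' := congrArg (leafMap P h.pow_eq) e
    rw [leafMap_leafProj, leafMap_leafProj, fibration_toS1S3, fibration_toS1S3] at e'
    obtain ⟨k, u, rfl⟩ := h.exists_flow_of_powRatio_eq e'.symm
    exact ⟨u, (toS1S3_deck P k _).symm⟩
  · rintro ⟨u, rfl⟩
    exact leafProj_flow P u z

end Hopf
end

theorem mainTheorem2 (P : Hopf.Params) (m₀ n₀ : ℤ) (hmn : ¬ (m₀ = 0 ∧ n₀ = 0))
    (hαβ : P.α ^ m₀ = P.β ^ n₀) :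
    ∃ m n : ℕ, 0 < m ∧ 0 < n ∧ P.α ^ m = P.β ^ n ∧
      (∀ m' n' : ℕ, 0 < m' → 0 < n' → P.α ^ m' = P.β ^ n' → m ≤ m' ∧ n ≤ n') ∧
      ∃ h : Hopf.LeafSpace P ≃ₜ Hopf.CP1,
        MDifferentiable 𝓘(ℂ, Hopf.C2) 𝓘(ℂ) (fun p : Hopf.S1S3 P => h (Hopf.leafProj P p)) ∧
        (∀ (p : Hopf.S1S3 P) (z : Hopf.puncturedC2),
          Hopf.F P p = Hopf.toSurface P z → h (Hopf.leafProj P p) = Hopf.powRatio m n z) ∧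
        ∀ δ : Hopf.LeafSpace P, ∃ (L : PeriodPair) (φ : ℂ → Hopf.S1S3 P),
          MDifferentiable 𝓘(ℂ) 𝓘(ℂ, Hopf.C2) φ ∧
          (∀ w, Function.Injective (mfderiv 𝓘(ℂ) 𝓘(ℂ, Hopf.C2) φ w)) ∧
          (∀ u v, φ u = φ v ↔ u - v ∈ L.lattice) ∧
          Set.range φ = Hopf.leafProj P ⁻¹' {δ} := by
  obtain ⟨m, n, h⟩ := P.exists_isLeastRelation (P.exists_pos_pow_eq hmn hαβ)
  refine ⟨m, n, h.pos_left, h.pos_right, h.pow_eq, h.le, Hopf.leafHomeomorph P h, ?_, ?_, ?_⟩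
  · exact Hopf.mdifferentiable_of_comp_toS1S3 (Hopf.fibration_toS1S3 h.pow_eq)
  · exact fun p z hp => Hopf.fibration_of_F_eq h.pow_eq hp
  · intro δ
    obtain ⟨p, rfl⟩ := Quot.exists_rep δ
    obtain ⟨z, rfl⟩ := Hopf.toS1S3_surjective P p
    obtain ⟨L, hL⟩ := h.exists_periodPair_flow z
    refine ⟨L, fun u => Hopf.toS1S3 P (Hopf.flow P u z),
      fun u => (Hopf.mdifferentiableAt_toS1S3_flow P z u).1,
      fun u => (Hopf.mdifferentiableAt_toS1S3_flow P z u).2, fun u v => ?_, ?_⟩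
    · rw [hL, eq_comm, Hopf.toS1S3_eq_iff]
      refine exists_congr fun k => ?_
      -- The flow commutes with the deck group and is injective at time v, so time v cancels and
      -- only u - v remains.
      rw [← Hopf.flow_deck, ← (Hopf.flow_injective P v).eq_iff (b := Hopf.deck P k z),
        ← Hopf.flow_add, add_sub_cancel]
    · ext q
      exact (Hopf.leafProj_eq_iff h).symm
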